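/- Let $\beta>0$. A $d$-level quantum system has initial Hamiltonian $H$ with energies $(\mathcal E_s)_s$ and final Hamiltonian $H'$ with energies $(\mathcal E'_s)_s$; put $\mathcal Z=\sum_s e^{-\beta\mathcal E_s}$ and $\mathcal Z'=\sum_s e^{-\beta\mathcal E'_s}$. *Thermal operations with fluctuating work.* The system is coupled to a bath with Hamiltonian $H_{\rm B}$ in its Gibbs state $\rho_{\rm B}=e^{-\beta H_{\rm B}}/\mathrm{tr}\,e^{-\beta H_{\rm B}}$ and to a weight with orthonormal position basis $\{|x\rangle : x\in\mathbb R\}$ and Hamiltonian $H_{\rm W}|x\rangle=x|x\rangle$. A thermal operation is given by such a bath and a joint unitary $U$ with $U(H+H_{\rm B}+H_{\rm W})=(H'+H_{\rm B}+H_{\rm W})U$ that commutes with the translations of the weight. The position of the weight is measured before and after; its displacement is the extracted work $w$. Thus a state $\rho$ yields the work $w$ with probability $P(w)=\mathrm{tr}\,\Lambda(\rho,w)$, where $\Lambda(\rho,w)=\mathrm{tr}_{\rm BW}\big[Q_w U(\rho\otimes\rho_{\rm B}\otimes Q_0)U^\dagger\big]$ and $Q_x=|x\rangle\langle x|$ (by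 translation invariance the initial position is irrelevant), and the final state is $\sum_w\Lambda(\rho,w)$. The infinite thermal bath is understood as a limit: a probability law $P$ on $\mathbb R$ is an attainable work law if it is the weak limit of the work laws of a sequence of thermal operations. It is $c$-bounded if it has a finite mean $\langle w\rangle_P$ and $|w-\langle w\rangle_P|\le c$ holds $P$-almost surely. *$c$-bounded work.* The $c$-bounded work content $W^{(c)}(\rho)$ is the supremum of $\langle w\rangle_P$ over all $c$-bounded work laws $P$ attainable from $\rho$, the final state being arbitrary. The $c$-bounded work of formation $W_F^{(c)}(\rho)$ is the infimum of the average cost $-\langle w\rangle_P$ over all $c$-bounded work laws $P$ attainable from the Gibbs state $e^{-\beta H}/\mathcal Z$ by a sequence of thermal operations whose final states converge to $\rho$ up to coherences between different energies of $H'$ (if $\rho$ has no such coherences, this means that the final states converge to $\rho$). **Theorem.** (1) Let $\rho$ be any density matrix, and let $x_s=\langle s|\rho|s\rangle$ be its populations in an eigenbasis of $H$ that also diagonalises the dephased state of $\rho$ (obtained by removing all coherences between different energies of $H$). With $x^0=1$ for $x>0$ and $0^0=0$, $$\lim_{c\to0^+}W^{(c)}(\rho)=W_{\min}(\rho)=\frac1\beta\log\mathcal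 Z'-\frac1\beta\log\sum_s x_s^0\,e^{-\beta\mathcal E_s}.$$ (2) Let $\rho$ be any density matrix, and let $x_s=\langle s|\rho|s\rangle$ be its populations in an eigenbasis of $H'$ that also diagonalises the dephased state of $\rho$ with respect to $H'$. Then $$\lim_{c\to0^+}W_F^{(c)}(\rho)=W_F^{\min}(\rho)=\frac1\beta\log\mathcal Z+\frac1\beta\log\max_s x_s\,e^{\beta\mathcal E'_s}.$$ -/

import Mathlib

open Filter Topology MeasureTheory
open scoped ComplexOrder

namespace FluctuatingWork

/-- Basis labels of the joint Hilbert space of system, bath and weight: the vector `|s, b, x⟩` is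
the system energy level `s`, the bath energy level `b` and the weight at position `x`. -/
abbrev Label (S B : Type*) := S × B × ℝ

/-- The joint Hilbert space with orthonormal basis `|s, b, x⟩`. -/
noncomputable abbrev Joint (S B : Type*) := lp (fun _ : Label S B => ℂ) 2

open Classical in
/-- The basis vector `|i⟩`. -/
noncomputable def ket {S B : Type*} (i : Label S B) : Joint S B := lp.single 2 i 1

/-- The eigenvalue of `H_S + H_B + H_W` on `|s, b, x⟩`. -/
def totalEnergy {S B : Type*} (E : S → ℝ) (ε : B → ℝ) (i : Label S B) : ℝ :=
  E i.1 + ε i.2.1 + i.2.2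

/-- The matrix element `⟨j| U |i⟩`. -/
noncomputable def amp {S B : Type*} (U : Joint S B ≃ₗᵢ[ℂ] Joint S B) (j i : Label S B) : ℂ :=
  inner ℂ (ket j) (U (ket i))

/-- A thermal operation with fluctuating work, at inverse temperature `β`, that changes the system
Hamiltonian from `H_S` (energies `E`) to `H'_S` (energies `E'`). Input states are written in the
eigenbasis of `H_S` and output states in the eigenbasis of `H'_S`.

The bath is any bath that has a normalisable Gibbs state, that is, it has energy levels `ε b`
with a finite partition function. System, bath and weight evolve by a unitary `U`
(microscopic reversibility). -/
structure ThermalOperation {S : Type*} (β : ℝ) (E E' : S → ℝ) where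
  /-- energy levels of the bath -/
  B : Type
  /-- energies of the bath -/
  ε : B → ℝ
  bath_nonempty : Nonempty B
  bath_summable : Summable fun b => Real.exp (-β * ε b)
  /-- the joint evolution -/
  U : Joint S B ≃ₗᵢ[ℂ] Joint S B
  /-- Energy conservation `(H'_S + H_B + H_W) U = U (H_S + H_B + H_W)`, in matrix elements. -/
  energy_conservation : ∀ j i : Label S B,
    (totalEnergy E' ε j : ℂ) * amp U j i = amp U j i * (totalEnergy E ε i : ℂ)
  /-- `U` commutes with the translations of the weight, in matrix elements. -/
  translation_invariance : ∀ (s' s : S) (b' b : B) (y x a : ℝ),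
    amp U (s', b', y + a) (s, b, x + a) = amp U (s', b', y) (s, b, x)

namespace ThermalOperation

variable {S : Type*} [Fintype S] {β : ℝ} {E E' : S → ℝ}

/-- Population of the bath level `b` in the Gibbs state of the bath. -/
noncomputable def bathProb (T : ThermalOperation β E E') (b : T.B) : ℝ :=
  Real.exp (-β * T.ε b) / ∑' a, Real.exp (-β * T.ε a)

/-- The unnormalised final system state given that the position of the weight is measured before
and after and that the work `w` has been found:
`Λ(ρ, w) = tr_BW [Q_w U (ρ ⊗ ρ_B ⊗ |0⟩⟨0|) U†]`, where `Q_w = |w⟩⟨w|`.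
Because of translation invariance the initial position of the weight (here `0`), and more
generally its initial distribution, is irrelevant. -/
noncomputable def outcome (T : ThermalOperation β E E') (ρ : Matrix S S ℂ) (w : ℝ) :
    Matrix S S ℂ :=
  Matrix.of fun s' t' => ∑' p : T.B × T.B, ∑ s : S, ∑ t : S,
    (T.bathProb p.1 : ℂ) * ρ s t * amp T.U (s', p.2, w) (s, p.1, 0)
      * (starRingEnd ℂ) (amp T.U (t', p.2, w) (t, p.1, 0))

/-- The probability `P(w) = tr Λ(ρ, w)` that the work `w` is extracted. -/
noncomputable def workProb (T : ThermalOperation β E E') (ρ : Matrix S S ℂ) (w : ℝ) : ℝ :=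
  (T.outcome ρ w).trace.re

/-- The final state `∑_w Λ(ρ, w)` of the system. -/
noncomputable def finalState (T : ThermalOperation β E E') (ρ : Matrix S S ℂ) : Matrix S S ℂ :=
  Matrix.of fun s' t' => ∑' w : ℝ, T.outcome ρ w s' t'

end ThermalOperation

section

variable {S : Type*} [Fintype S]

/-- Density matrices. -/
def IsState (ρ : Matrix S S ℂ) : Prop := ρ.PosSemidef ∧ ρ.trace = 1

/-- Removal of the coherences between different energies (projection on the zero mode). -/
noncomputable def dephase (E : S → ℝ) (ρ : Matrix S S ℂ) : Matrix S S ℂ :=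
  Matrix.of fun s t => if E s = E t then ρ s t else 0

/-- Population `x_s = ⟨s|ρ|s⟩`. -/
def population (ρ : Matrix S S ℂ) (s : S) : ℝ := (ρ s s).re

/-- `Z = tr e^{-βH}`. -/
noncomputable def partitionFunction (β : ℝ) (E : S → ℝ) : ℝ := ∑ s, Real.exp (-β * E s)

open Classical in
/-- The Gibbs state of the system. -/
noncomputable def gibbsState (β : ℝ) (E : S → ℝ) : Matrix S S ℂ :=
  Matrix.diagonal fun s => ((Real.exp (-β * E s) / partitionFunction β E : ℝ) : ℂ)

/-- The work statistics of the operations `T n` on `ρ` converge weakly to `P`. -/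
def WorkTendsto {β : ℝ} {E E' : S → ℝ} (T : ℕ → ThermalOperation β E E') (ρ : Matrix S S ℂ)
    (P : Measure ℝ) : Prop :=
  ∀ f : BoundedContinuousFunction ℝ ℝ,
    Tendsto (fun n => ∑' w : ℝ, (T n).workProb ρ w * f w) atTop (𝓝 (∫ w, f w ∂P))

/-- `P` is a probability law of the work under which the work deviates from its average by at
most `c` (with probability one). -/
structure IsBoundedLaw (c : ℝ) (P : Measure ℝ) : Prop where
  prob : IsProbabilityMeasure P
  integrable : Integrable (fun w : ℝ => w) P
  bounded : ∀ᵐ w ∂P, |w - ∫ v, v ∂P| ≤ c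

/-- Laws of the work extracted from `ρ`. The thermal bath is infinite: this idealisation is the
limit of thermal operations with baths that have a normalisable Gibbs state. There is no
condition on the final state of the system. -/
def extractionLaws (β : ℝ) (E E' : S → ℝ) (ρ : Matrix S S ℂ) : Set (Measure ℝ) :=
  {P | ∃ T : ℕ → ThermalOperation β E E', WorkTendsto T ρ P}

/-- Laws of the work in the formation of `ρ` from the Gibbs state of the initial Hamiltonian, in
the same idealisation. A thermal operation creates no coherences between different energies
from a Gibbs state, so the final state is compared with `ρ` after dephasing; if `ρ` has no such
coherences, the final states themselves converge to `ρ`. -/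
def formationLaws (β : ℝ) (E E' : S → ℝ) (ρ : Matrix S S ℂ) : Set (Measure ℝ) :=
  {P | ∃ T : ℕ → ThermalOperation β E E', WorkTendsto T (gibbsState β E) P ∧
    Tendsto (fun n => dephase E' ((T n).finalState (gibbsState β E))) atTop (𝓝 (dephase E' ρ))}

/-- The `c`-bounded work content: the optimal average of the extracted work. -/
noncomputable def boundedWork (β : ℝ) (E E' : S → ℝ) (ρ : Matrix S S ℂ) (c : ℝ) : EReal :=
  ⨆ P ∈ {P | P ∈ extractionLaws β E E' ρ ∧ IsBoundedLaw c P}, ((∫ w, w ∂P : ℝ) : EReal)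

/-- The `c`-bounded work of formation: the minimal average work cost. As `w` is the work that the
weight gains, the cost is `-w`. -/
noncomputable def boundedWorkOfFormation (β : ℝ) (E E' : S → ℝ) (ρ : Matrix S S ℂ) (c : ℝ) :
    EReal :=
  ⨅ P ∈ {P | P ∈ formationLaws β E E' ρ ∧ IsBoundedLaw c P}, ((-∫ w, w ∂P : ℝ) : EReal)

/-- Min free energy `-β⁻¹ log ∑_s x_s^0 e^{-βE_s}` (with `0^0 = 0`). -/
noncomputable def minFreeEnergy (β : ℝ) (E : S → ℝ) (x : S → ℝ) : ℝ :=
  -(1 / β * Real.log (∑ s, (if x s = 0 then 0 else 1) * Real.exp (-β * E s)))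

/-- Max free energy `β⁻¹ log max_s x_s e^{βE_s}`. -/
noncomputable def maxFreeEnergy (β : ℝ) (E : S → ℝ) (x : S → ℝ) : ℝ :=
  1 / β * Real.log (⨆ s, x s * Real.exp (β * E s))

/-- Single-shot work content `W_min = β⁻¹ log Z' - β⁻¹ log ∑_s x_s^0 e^{-βE_s}`. -/
noncomputable def singleShotWork (β : ℝ) (E E' : S → ℝ) (x : S → ℝ) : ℝ :=
  1 / β * Real.log (partitionFunction β E') + minFreeEnergy β E x

/-- Single-shot work of formation `W_F^min = β⁻¹ log Z + β⁻¹ log max_s x_s e^{βE'_s}`. -/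
noncomputable def singleShotWorkOfFormation (β : ℝ) (E E' : S → ℝ) (x : S → ℝ) : ℝ :=
  1 / β * Real.log (partitionFunction β E) + maxFreeEnergy β E' x

end

end FluctuatingWork

namespace FluctuatingWork

/-! ### Transition probabilities of a thermal operation and the second law -/

section

section amplitudes

variable {S B : Type*}

/-! Coherences between different energies never reach the work statistics or the final populations,
so everything is governed by the probabilities `p(s', w | s)`, formalised as `kernel`. Unitarity
constrains them twice. Normalised columns of `U` give `∑_{s',w} p(s', w | s) = 1`. Normalised rows,
combined with the Gibbs weights of the bath and energy conservation, give `∑_{s,w} p(s', w | s)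
e^{β(E'_{s'} - E_s + w)} = 1` for every `s'` (`second_law`).

Converse: a `c`-bounded law with mean `m` lives on `w ≥ m - c`, so the exponential in the second law
is at least its value at `w = m - c`, up to a cutoff width `δ` that is sent to zero. For extraction,
every populated level must yield such work with conditional probability tending to one; summing the
second law over `s'` gives `e^{β(m-c)} ∑_s x_s^0 e^{-βE_s} ≤ Z'` (`supportSum_mul_exp_le`). For
formation, averaging over the initial Gibbs state gives `x_{s'} Z e^{β(E'_{s'} + m - c)} ≤ 1` for
each `s'` (`population_mul_exp_le`). Logarithms yield the two bounds with an error `c`.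

Attainability: conversely, a strict second law `y_{s'} ∑_{s∈D} e^{β(w₁ + E'_{s'} - E_s)} < 1`
suffices to send all levels of `D` to the distribution `y` with work close to `w₁`
(`exists_operation_near`). The bath is a long ladder whose degeneracy grows by the factor `e^{βη}`
per rung of height `η`, so all rungs are equally likely. The second law becomes a comparison of
numbers of levels, and a permutation of levels realises the transition away from the ends of the
ladder. Extraction takes `D` to be the populated levels and `y` the final Gibbs distribution;
formation takes `D` to be all levels and `y = x`. Deterministic work is `c`-bounded for all `c ≥ 0`,
and the two bounds squeeze the limit. -/

lemma norm_ket (i : Label S B) : ‖ket i‖ = 1 := by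
  classical
  simp [ket, lp.norm_single]

lemma inner_ket_left (i : Label S B) (v : Joint S B) : inner ℂ (ket i) v = v i := by
  classical
  simp [ket, lp.inner_single_left]

lemma amp_eq_apply (U : Joint S B ≃ₗᵢ[ℂ] Joint S B) (j i : Label S B) :
    amp U j i = U (ket i) j := by
  rw [amp, inner_ket_left]

/-- Since the inverse of `U` is its adjoint, row sums of `U` become column sums of `U.symm`. -/
lemma enorm_amp_eq_enorm_amp_symm (U : Joint S B ≃ₗᵢ[ℂ] Joint S B) (j i : Label S B) :
    ‖amp U j i‖ₑ = ‖amp U.symm i j‖ₑ := by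
  have h : amp U j i = (starRingEnd ℂ) (amp U.symm i j) := by
    unfold amp
    rw [inner_conj_symm, ← U.inner_map_map (U.symm (ket j)), U.apply_symm_apply]
  rw [h, ← ofReal_norm, ← ofReal_norm, RCLike.norm_conj]

lemma tsum_enorm_sq_apply (v : Joint S B) (hv : ‖v‖ = 1) : ∑' j, ‖v j‖ₑ ^ 2 = 1 := by
  have h := lp.hasSum_norm (p := 2) (by norm_num) v
  simp only [hv, ENNReal.toReal_ofNat, Real.rpow_two, one_pow] at h
  have h2 := ENNReal.ofReal_tsum_of_nonneg (fun j => sq_nonneg ‖v j‖) h.summable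
  rw [h.tsum_eq, ENNReal.ofReal_one] at h2
  rw [h2]
  refine tsum_congr fun j => ?_
  rw [ENNReal.ofReal_pow (norm_nonneg _), ofReal_norm]

/-- The columns of a unitary are normalised. -/
lemma tsum_enorm_sq_amp_left (U : Joint S B ≃ₗᵢ[ℂ] Joint S B) (i : Label S B) :
    ∑' j, ‖amp U j i‖ₑ ^ 2 = 1 := by
  simp_rw [amp_eq_apply]
  exact tsum_enorm_sq_apply _ (by rw [U.norm_map, norm_ket])

/-- The rows of a unitary are normalised. -/
lemma tsum_enorm_sq_amp_right (U : Joint S B ≃ₗᵢ[ℂ] Joint S B) (j : Label S B) :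
    ∑' i, ‖amp U j i‖ₑ ^ 2 = 1 := by
  simp_rw [enorm_amp_eq_enorm_amp_symm U]
  exact tsum_enorm_sq_amp_left _ _

lemma amp_mul_amp_conj_eq (U : Joint S B ≃ₗᵢ[ℂ] Joint S B) (j i : Label S B) :
    amp U j i * (starRingEnd ℂ) (amp U j i) = ((‖amp U j i‖ₑ ^ 2).toReal : ℂ) := by
  rw [Complex.mul_conj, Complex.normSq_eq_norm_sq, ENNReal.toReal_pow, toReal_enorm]

end amplitudes

lemma apply_self_eq_population {S : Type*} [Fintype S] {ρ : Matrix S S ℂ} (hρ : ρ.PosSemidef)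
    (s : S) : ρ s s = (population ρ s : ℂ) := by
  have := hρ.diag_nonneg (i := s)
  rw [Complex.le_def] at this
  apply Complex.ext
  · simp [population]
  · simpa using this.2.symm

namespace ThermalOperation

variable {S : Type*} {β : ℝ} {E E' : S → ℝ} (T : ThermalOperation β E E')

lemma energy_eq_of_amp_ne_zero {j i : Label S T.B} (h : amp T.U j i ≠ 0) :
    totalEnergy E' T.ε j = totalEnergy E T.ε i := by
  have := T.energy_conservation j i
  rw [mul_comm] at this
  exact_mod_cast mul_left_cancel₀ h this

lemma bathProb_nonneg (b : T.B) : 0 ≤ T.bathProb b :=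
  div_nonneg (Real.exp_pos _).le (tsum_nonneg fun _ => (Real.exp_pos _).le)

lemma bathPartition_pos : 0 < ∑' a, Real.exp (-β * T.ε a) := by
  obtain ⟨b⟩ := T.bath_nonempty
  exact T.bath_summable.tsum_pos (fun _ => (Real.exp_pos _).le) b (Real.exp_pos _)

lemma tsum_ofReal_bathProb : ∑' b, ENNReal.ofReal (T.bathProb b) = 1 := by
  rw [← ENNReal.ofReal_tsum_of_nonneg T.bathProb_nonneg (T.bath_summable.div_const _)]
  unfold bathProb
  rw [tsum_div_const, div_self T.bathPartition_pos.ne', ENNReal.ofReal_one]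

/-- Detailed balance of the bath: this turns the weight of the initial bath level into that of the
final one in the second law. -/
lemma bathProb_mul_exp (b b' : T.B) :
    T.bathProb b * Real.exp (β * (T.ε b - T.ε b')) = T.bathProb b' := by
  unfold bathProb
  rw [div_mul_eq_mul_div, ← Real.exp_add]
  congr 2
  ring

/-- The probability that the system goes from the level `s` to the level `s'` while the work `w`
is extracted. -/
noncomputable def kernel (s' s : S) (w : ℝ) : ENNReal :=
  ∑' p : T.B × T.B, ENNReal.ofReal (T.bathProb p.1) *
    ‖amp T.U (s', p.2, w) (s, p.1, 0)‖ₑ ^ 2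

lemma amp_translate (s' s : S) (b' b : T.B) (w : ℝ) :
    amp T.U (s', b', 0) (s, b, -w) = amp T.U (s', b', w) (s, b, 0) := by
  have := T.translation_invariance s' s b' b 0 (-w) w
  rw [← this]; simp

/-- The average of `f w` on the event that the system goes from `s` to `s'`. -/
noncomputable def avg (f : ℝ → ℝ) (s' s : S) : ℝ := ∑' w, (T.kernel s' s w).toReal * f w

lemma avg_nonneg {f : ℝ → ℝ} (hf : ∀ w, 0 ≤ f w) (s' s : S) : 0 ≤ T.avg f s' s :=
  tsum_nonneg fun w => mul_nonneg ENNReal.toReal_nonneg (hf w)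

variable [Fintype S]

/-- Summation over labels, energy level of the system first. -/
lemma tsum_label {B : Type*} (f : Label S B → ENNReal) :
    ∑' i, f i = ∑ s, ∑' w, ∑' b, f (s, b, w) := by
  rw [ENNReal.tsum_prod' , tsum_fintype]
  refine Finset.sum_congr rfl fun s _ => ?_
  rw [ENNReal.tsum_prod', ENNReal.tsum_comm]

/-- Normalisation of the transition probabilities. -/
lemma sum_tsum_kernel (s : S) : ∑ s', ∑' w, T.kernel s' s w = 1 := by
  unfold kernel
  calc _ = ∑' b, ENNReal.ofReal (T.bathProb b) * ∑' j, ‖amp T.U j (s, b, 0)‖ₑ ^ 2 := by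
        simp_rw [tsum_label, Finset.mul_sum, ENNReal.tsum_prod']
        rw [Summable.tsum_finsetSum fun _ _ => ENNReal.summable]
        refine Finset.sum_congr rfl fun s' _ => ?_
        rw [ENNReal.tsum_comm]
        simp_rw [ENNReal.tsum_mul_left]
    _ = 1 := by simp [tsum_enorm_sq_amp_left, T.tsum_ofReal_bathProb]

/-- The second law of thermodynamics for thermal operations with fluctuating work. -/
lemma second_law (s' : S) :
    ∑ s, ∑' w, T.kernel s' s w * ENNReal.ofReal (Real.exp (β * (E' s' - E s + w))) = 1 := by
  unfold kernel
  -- Energy conservation makes the exponential equal to the ratio of the Gibbs weights of the final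
  -- and initial bath levels. Translating the weight fixes its final position at `0`, so that the
  -- remaining sum runs along a row of `U`.
  have key : ∀ s w (p : T.B × T.B),
      ENNReal.ofReal (T.bathProb p.1) * ‖amp T.U (s', p.2, w) (s, p.1, 0)‖ₑ ^ 2
        * ENNReal.ofReal (Real.exp (β * (E' s' - E s + w)))
      = ENNReal.ofReal (T.bathProb p.2) * ‖amp T.U (s', p.2, 0) (s, p.1, -w)‖ₑ ^ 2 := by
    intro s w p
    rw [T.amp_translate]
    by_cases h : amp T.U (s', p.2, w) (s, p.1, 0) = 0
    · simp [h]
    have h2 := T.energy_eq_of_amp_ne_zero h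
    simp only [totalEnergy] at h2
    rw [mul_right_comm, ← ENNReal.ofReal_mul (T.bathProb_nonneg _), ← T.bathProb_mul_exp p.1 p.2]
    congr 5
    linarith
  calc _ = ∑' b, ENNReal.ofReal (T.bathProb b) * ∑' i, ‖amp T.U (s', b, 0) i‖ₑ ^ 2 := by
        simp_rw [tsum_label, Finset.mul_sum, ← ENNReal.tsum_mul_right, key]
        rw [Summable.tsum_finsetSum fun _ _ => ENNReal.summable]
        refine Finset.sum_congr rfl fun s _ => ?_
        simp_rw [ENNReal.tsum_prod']
        conv_lhs => enter [1, w]; rw [ENNReal.tsum_comm]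
        rw [ENNReal.tsum_comm]
        refine tsum_congr fun b' => ?_
        simp_rw [ENNReal.tsum_mul_left]
        congr 1
        exact (Equiv.neg ℝ).tsum_eq (fun w => ∑' b, ‖amp T.U (s', b', 0) (s, b, w)‖ₑ ^ 2)
    _ = 1 := by simp [tsum_enorm_sq_amp_right, T.tsum_ofReal_bathProb]

lemma tsum_kernel_le_one (s' s : S) : ∑' w, T.kernel s' s w ≤ 1 := by
  rw [← T.sum_tsum_kernel s]
  exact Finset.single_le_sum (f := fun s' => ∑' w, T.kernel s' s w) (fun _ _ => zero_le)
    (Finset.mem_univ s')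

lemma kernel_ne_top (s' s : S) (w : ℝ) : T.kernel s' s w ≠ ⊤ :=
  ne_top_of_le_ne_top ENNReal.one_ne_top
    ((ENNReal.le_tsum (f := T.kernel s' s) w).trans (T.tsum_kernel_le_one s' s))

lemma summable_kernel (s' s : S) : Summable fun w => (T.kernel s' s w).toReal :=
  ENNReal.summable_toReal (ne_top_of_le_ne_top ENNReal.one_ne_top (T.tsum_kernel_le_one s' s))

lemma summable_kernel_mul {f : ℝ → ℝ} {C : ℝ} (hf : ∀ w, |f w| ≤ C) (s' s : S) :
    Summable fun w => (T.kernel s' s w).toReal * f w := by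
  refine Summable.of_norm_bounded ((T.summable_kernel s' s).mul_right C) fun w => ?_
  rw [norm_mul, Real.norm_of_nonneg ENNReal.toReal_nonneg]
  exact mul_le_mul_of_nonneg_left (hf w) ENNReal.toReal_nonneg

lemma sum_avg_one (s : S) : ∑ s', T.avg (fun _ => 1) s' s = 1 := by
  unfold avg
  simp only [mul_one]
  rw [← ENNReal.toReal_one, ← T.sum_tsum_kernel s, ENNReal.toReal_sum]
  · exact Finset.sum_congr rfl fun s' _ =>
      (ENNReal.tsum_toReal_eq fun w => T.kernel_ne_top s' s w).symm
  · exact fun s' _ => ne_top_of_le_ne_top ENNReal.one_ne_top (T.tsum_kernel_le_one s' s)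

lemma avg_mono {f g : ℝ → ℝ} {C D : ℝ} (hf : ∀ w, |f w| ≤ C) (hg : ∀ w, |g w| ≤ D)
    (h : ∀ w, f w ≤ g w) (s' s : S) : T.avg f s' s ≤ T.avg g s' s :=
  (T.summable_kernel_mul hf s' s).tsum_le_tsum
    (fun w => mul_le_mul_of_nonneg_left (h w) ENNReal.toReal_nonneg)
    (T.summable_kernel_mul hg s' s)

lemma avg_le_avg_one {f : ℝ → ℝ} (hf : ∀ w, 0 ≤ f w) (hf1 : ∀ w, f w ≤ 1) (s' s : S) :
    T.avg f s' s ≤ T.avg (fun _ => 1) s' s :=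
  T.avg_mono (C := 1) (D := 1) (fun w => abs_le.2 ⟨by linarith [hf w], hf1 w⟩) (by simp) hf1 s' s

lemma sum_avg_le_one {f : ℝ → ℝ} (hf : ∀ w, 0 ≤ f w) (hf1 : ∀ w, f w ≤ 1) (s : S) :
    ∑ s', T.avg f s' s ≤ 1 := by
  rw [← T.sum_avg_one s]
  exact Finset.sum_le_sum fun s' _ => T.avg_le_avg_one hf hf1 s' s

/-- The second law restricted to the event that at least the work `a` is extracted. -/
lemma second_law_of_le (hβ : 0 < β) {f : ℝ → ℝ} {a : ℝ} (hf : ∀ w, 0 ≤ f w) (hf1 : ∀ w, f w ≤ 1)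
    (hfa : ∀ w < a, f w = 0) (s' : S) :
    ∑ s, Real.exp (-β * E s) * T.avg f s' s ≤ Real.exp (-β * (E' s' + a)) := by
  have h := T.second_law s'
  have hle : ∀ s w, ENNReal.ofReal ((T.kernel s' s w).toReal * f w *
      Real.exp (β * (E' s' - E s + a))) ≤
      T.kernel s' s w * ENNReal.ofReal (Real.exp (β * (E' s' - E s + w))) := by
    intro s w
    rcases lt_or_ge w a with hw | hw
    · simp [hfa w hw]
    · rw [← ENNReal.ofReal_toReal (T.kernel_ne_top s' s w),
        ← ENNReal.ofReal_mul ENNReal.toReal_nonneg]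
      rw [ENNReal.toReal_ofReal ENNReal.toReal_nonneg]
      refine ENNReal.ofReal_le_ofReal (mul_le_mul
        (mul_le_of_le_one_right ENNReal.toReal_nonneg (hf1 w)) ?_ (Real.exp_pos _).le
        ENNReal.toReal_nonneg)
      gcongr
  have hsum : ENNReal.ofReal (∑ s, T.avg f s' s * Real.exp (β * (E' s' - E s + a))) ≤ 1 := by
    rw [← h, ENNReal.ofReal_sum_of_nonneg
      fun s _ => mul_nonneg (T.avg_nonneg hf s' s) (Real.exp_pos _).le]
    refine Finset.sum_le_sum fun s _ => ?_
    rw [avg, ← tsum_mul_right, ENNReal.ofReal_tsum_of_nonneg]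
    · exact ENNReal.tsum_le_tsum (hle s)
    · exact fun w => mul_nonneg (mul_nonneg ENNReal.toReal_nonneg (hf w)) (Real.exp_pos _).le
    · exact (T.summable_kernel_mul (C := 1) (fun w => abs_le.2 ⟨by linarith [hf w], hf1 w⟩)
        s' s).mul_right _
  rw [ENNReal.ofReal_le_one] at hsum
  calc _ = Real.exp (-β * (E' s' + a)) *
        ∑ s, T.avg f s' s * Real.exp (β * (E' s' - E s + a)) := by
        rw [Finset.mul_sum]
        refine Finset.sum_congr rfl fun s _ => ?_
        rw [mul_comm, mul_left_comm, ← Real.exp_add]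
        congr 2
        ring
    _ ≤ _ := mul_le_of_le_one_right (Real.exp_pos _).le hsum

/-- Two initial levels with the same bath level and weight position can reach a common final label
only if their energies agree; there the off-diagonal entries of `ρ` vanish by the choice of basis.
-/
lemma outcome_apply_self {ρ : Matrix S S ℂ} (hρ : ρ.PosSemidef) (hd : (dephase E ρ).IsDiag)
    (s' : S) (w : ℝ) :
    T.outcome ρ w s' s' = ((∑ s, population ρ s * (T.kernel s' s w).toReal : ℝ) : ℂ) := by
  classical
  have hterm : ∀ p : T.B × T.B, ∑ s : S, ∑ t : S,
      (T.bathProb p.1 : ℂ) * ρ s t * amp T.U (s', p.2, w) (s, p.1, 0)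
        * (starRingEnd ℂ) (amp T.U (s', p.2, w) (t, p.1, 0)) =
      ((∑ s, population ρ s * (ENNReal.ofReal (T.bathProb p.1) *
        ‖amp T.U (s', p.2, w) (s, p.1, 0)‖ₑ ^ 2).toReal : ℝ) : ℂ) := by
    intro p
    rw [Complex.ofReal_sum]
    refine Finset.sum_congr rfl fun s _ => ?_
    rw [Finset.sum_eq_single s]
    · rw [mul_assoc, amp_mul_amp_conj_eq, apply_self_eq_population hρ, ENNReal.toReal_mul,
        ENNReal.toReal_ofReal (T.bathProb_nonneg _)]
      push_cast
      ring
    · intro t _ hts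
      by_cases h1 : amp T.U (s', p.2, w) (s, p.1, 0) = 0
      · simp [h1]
      by_cases h2 : amp T.U (s', p.2, w) (t, p.1, 0) = 0
      · simp [h2]
      have e1 := T.energy_eq_of_amp_ne_zero h1
      have e2 := T.energy_eq_of_amp_ne_zero h2
      simp only [totalEnergy] at e1 e2
      have e3 : E s = E t := by linarith
      have := hd (Ne.symm hts)
      simp only [dephase, Matrix.of_apply, e3, if_true] at this
      simp [this]
    · simp
  have hne : ∀ s (p : T.B × T.B), ENNReal.ofReal (T.bathProb p.1) *
      ‖amp T.U (s', p.2, w) (s, p.1, 0)‖ₑ ^ 2 ≠ ⊤ := fun s p =>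
    ENNReal.mul_ne_top ENNReal.ofReal_ne_top (ENNReal.pow_ne_top enorm_ne_top)
  simp only [outcome, Matrix.of_apply]
  rw [tsum_congr hterm, ← Complex.ofReal_tsum, Summable.tsum_finsetSum]
  · congr 1
    refine Finset.sum_congr rfl fun s _ => ?_
    rw [tsum_mul_left, kernel, ENNReal.tsum_toReal_eq (hne s)]
  · exact fun s _ => (ENNReal.summable_toReal (T.kernel_ne_top s' s w)).mul_left _

lemma workProb_eq {ρ : Matrix S S ℂ} (hρ : ρ.PosSemidef) (hd : (dephase E ρ).IsDiag) (w : ℝ) :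
    T.workProb ρ w = ∑ s, population ρ s * ∑ s', (T.kernel s' s w).toReal := by
  rw [workProb, Matrix.trace]
  simp only [Matrix.diag_apply, T.outcome_apply_self hρ hd, Complex.re_sum, Complex.ofReal_re]
  rw [Finset.sum_comm]
  simp_rw [Finset.mul_sum]

lemma tsum_workProb_mul {ρ : Matrix S S ℂ} (hρ : ρ.PosSemidef) (hd : (dephase E ρ).IsDiag)
    {f : ℝ → ℝ} {C : ℝ} (hf : ∀ w, |f w| ≤ C) :
    ∑' w, T.workProb ρ w * f w = ∑ s, population ρ s * ∑ s', T.avg f s' s := by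
  simp_rw [T.workProb_eq hρ hd, Finset.sum_mul, mul_assoc, Finset.sum_mul]
  rw [Summable.tsum_finsetSum]
  · refine Finset.sum_congr rfl fun s _ => ?_
    rw [tsum_mul_left, Summable.tsum_finsetSum]
    · rfl
    · exact fun s' _ => T.summable_kernel_mul hf s' s
  · exact fun s _ => (summable_sum fun s' _ => T.summable_kernel_mul hf s' s).mul_left _

lemma finalState_apply_self {ρ : Matrix S S ℂ} (hρ : ρ.PosSemidef) (hd : (dephase E ρ).IsDiag)
    (s' : S) :
    T.finalState ρ s' s' = ((∑ s, population ρ s * T.avg (fun _ => 1) s' s : ℝ) : ℂ) := by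
  simp only [finalState, Matrix.of_apply, T.outcome_apply_self hρ hd]
  rw [← Complex.ofReal_tsum, Summable.tsum_finsetSum]
  · congr 1
    refine Finset.sum_congr rfl fun s _ => ?_
    simp [avg, tsum_mul_left]
  · exact fun s _ => (T.summable_kernel s' s).mul_left _

end ThermalOperation

end

/-! ### Upper bound on the work content and lower bound on the work of formation -/

section

/-- Weak convergence only tests continuous functions, so the indicator of `w ≥ m - c`, with `m` the
mean, is replaced by a ramp of width `δ`. -/
lemma IsBoundedLaw.exists_cutoff {c : ℝ} {P : Measure ℝ} (hP : IsBoundedLaw c P) {δ : ℝ}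
    (hδ : 0 < δ) :
    ∃ f : BoundedContinuousFunction ℝ ℝ, (∀ w, 0 ≤ f w) ∧ (∀ w, f w ≤ 1) ∧
      (∀ w < (∫ v, v ∂P) - c - δ, f w = 0) ∧ ∫ w, f w ∂P = 1 := by
  set m := ∫ v, v ∂P with hm
  have hpos : ∀ w : ℝ, 0 ≤ max 0 (min 1 ((w - (m - c - δ)) / δ)) := fun w => le_max_left _ _
  have hle : ∀ w : ℝ, max 0 (min 1 ((w - (m - c - δ)) / δ)) ≤ 1 := fun w =>
    max_le zero_le_one (min_le_left _ _)
  refine ⟨BoundedContinuousFunction.ofNormedAddCommGroup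
    (fun w : ℝ => max 0 (min 1 ((w - (m - c - δ)) / δ))) (by fun_prop) 1
    (fun w => by rw [Real.norm_of_nonneg (hpos w)]; exact hle w), hpos, hle, ?_, ?_⟩
  · intro w hw
    refine max_eq_left ((min_le_right _ _).trans ?_)
    exact div_nonpos_of_nonpos_of_nonneg (by linarith) hδ.le
  · have := hP.prob
    have : ∀ᵐ w ∂P, max 0 (min 1 ((w - (m - c - δ)) / δ)) = 1 := by
      filter_upwards [hP.bounded] with w hw
      have h1 : 1 ≤ (w - (m - c - δ)) / δ := by
        rw [le_div_iff₀ hδ]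
        linarith [(abs_le.1 hw).1]
      rw [min_eq_left h1, max_eq_right zero_le_one]
    simp only [BoundedContinuousFunction.coe_ofNormedAddCommGroup]
    rw [integral_congr_ae this]
    simp

variable {S : Type*} [Fintype S] {β : ℝ} {E E' : S → ℝ}

lemma IsState.population_nonneg {ρ : Matrix S S ℂ} (hρ : IsState ρ) (s : S) :
    0 ≤ population ρ s := by
  have := hρ.1.diag_nonneg (i := s)
  rw [Complex.le_def] at this
  exact this.1

lemma IsState.sum_population {ρ : Matrix S S ℂ} (hρ : IsState ρ) :
    ∑ s, population ρ s = 1 := by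
  have := congrArg Complex.re hρ.2
  simpa [Matrix.trace, population] using this

lemma IsState.nonempty {ρ : Matrix S S ℂ} (hρ : IsState ρ) : Nonempty S := by
  by_contra h
  rw [not_nonempty_iff] at h
  simpa using hρ.sum_population

lemma IsState.exists_population_pos {ρ : Matrix S S ℂ} (hρ : IsState ρ) :
    ∃ s, 0 < population ρ s := by
  by_contra! h
  have := Finset.sum_nonpos fun s (_ : s ∈ Finset.univ) => h s
  rw [hρ.sum_population] at this
  linarith

lemma partitionFunction_pos [Nonempty S] : 0 < partitionFunction β E :=
  Finset.sum_pos (fun _ _ => Real.exp_pos _) Finset.univ_nonempty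

lemma population_gibbsState (s : S) :
    population (gibbsState β E) s = Real.exp (-β * E s) / partitionFunction β E := by
  simp only [population, gibbsState, Matrix.diagonal_apply_eq, Complex.ofReal_re]

lemma isState_gibbsState [Nonempty S] : IsState (gibbsState β E) := by
  classical
  constructor
  · unfold gibbsState
    rw [Matrix.posSemidef_diagonal_iff]
    intro s
    exact_mod_cast (div_pos (Real.exp_pos _) partitionFunction_pos).le
  · simp only [gibbsState, Matrix.trace_diagonal]
    rw [← Complex.ofReal_sum, ← Finset.sum_div]
    exact_mod_cast div_self (partitionFunction_pos (β := β) (E := E)).ne'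

lemma isDiag_dephase_gibbsState : (dephase E (gibbsState β E)).IsDiag := by
  classical
  intro s t hst
  simp [dephase, gibbsState, Matrix.diagonal_apply_ne _ hst]

lemma tsum_workProb_eq_sum {ρ : Matrix S S ℂ} (hρ : IsState ρ) (hd : (dephase E ρ).IsDiag)
    (T : ThermalOperation β E E') {f : ℝ → ℝ} (hf : ∀ w, 0 ≤ f w) (hf1 : ∀ w, f w ≤ 1) :
    ∑' w, T.workProb ρ w * f w = ∑ s, population ρ s * ∑ s', T.avg f s' s :=
  T.tsum_workProb_mul hρ.1 hd (C := 1) (fun w => abs_le.2 ⟨by linarith [hf w], hf1 w⟩)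

/-- Sum over the levels that are populated in `ρ`. -/
noncomputable def supportSum (β : ℝ) (E x : S → ℝ) : ℝ :=
  ∑ s, (if x s = 0 then 0 else 1) * Real.exp (-β * E s)

lemma IsState.supportSum_pos {ρ : Matrix S S ℂ} (hρ : IsState ρ) :
    0 < supportSum β E (population ρ) := by
  obtain ⟨s, hs⟩ := hρ.exists_population_pos
  refine Finset.sum_pos' (fun t _ => ?_) ⟨s, Finset.mem_univ _, ?_⟩
  · exact mul_nonneg (by split_ifs <;> norm_num) (Real.exp_pos _).le
  · rw [if_neg hs.ne', one_mul]
    exact Real.exp_pos _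

lemma supportSum_mul_exp_le (hβ : 0 < β) {ρ : Matrix S S ℂ} (hρ : IsState ρ)
    (hd : (dephase E ρ).IsDiag) {c : ℝ} {P : Measure ℝ} (hP : IsBoundedLaw c P)
    (hPa : P ∈ extractionLaws β E E' ρ) {δ : ℝ} (hδ : 0 < δ) :
    supportSum β E (population ρ) * Real.exp (β * ((∫ w, w ∂P) - c - δ)) ≤
      partitionFunction β E' := by
  obtain ⟨T, hT⟩ := hPa
  obtain ⟨f, hf, hf1, hfa, hfP⟩ := hP.exists_cutoff hδ
  set a := (∫ w, w ∂P) - c - δ with ha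
  have hlim := hT f
  rw [hfP] at hlim
  set u : ℕ → ℝ := fun n => ∑' w, (T n).workProb ρ w * f w with hu
  -- The total deficit `1 - u n` bounds the deficit of level `s` weighted by its population.
  -- Division by the population is harmless for unpopulated levels, whose term carries the factor
  -- zero.
  have hb : ∀ n, ∑ s, (if population ρ s = 0 then 0 else 1) * Real.exp (-β * E s) *
      (1 - (1 - u n) / population ρ s) ≤ partitionFunction β E' * Real.exp (-β * a) := by
    intro n
    have hsum1 : ∑ s, Real.exp (-β * E s) * ∑ s', (T n).avg f s' s ≤
        partitionFunction β E' * Real.exp (-β * a) := by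
      simp_rw [Finset.mul_sum]
      rw [Finset.sum_comm, partitionFunction, Finset.sum_mul]
      refine Finset.sum_le_sum fun s' _ => ((T n).second_law_of_le hβ hf hf1 hfa s').trans_eq ?_
      rw [← Real.exp_add]
      ring_nf
    refine le_trans (Finset.sum_le_sum fun s _ => ?_) hsum1
    have hn : 0 ≤ ∑ s', (T n).avg f s' s :=
      Finset.sum_nonneg fun s' _ => (T n).avg_nonneg hf s' s
    by_cases hs : population ρ s = 0
    · simp only [hs, if_true, zero_mul]
      exact mul_nonneg (Real.exp_pos _).le hn
    have hs' : 0 < population ρ s := (hρ.population_nonneg s).lt_of_ne' hs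
    rw [if_neg hs, one_mul]
    refine mul_le_mul_of_nonneg_left ?_ (Real.exp_pos _).le
    have hu1 : u n = ∑ t, population ρ t * ∑ s', (T n).avg f s' t :=
      tsum_workProb_eq_sum hρ hd (T n) hf hf1
    have h1 : population ρ s * (1 - ∑ s', (T n).avg f s' s) ≤ 1 - u n := by
      refine le_of_le_of_eq ?_ (congrArg (· - u n) hρ.sum_population)
      simp only [hu1]
      rw [← Finset.sum_sub_distrib]
      refine le_trans (b := population ρ s - population ρ s * ∑ s', (T n).avg f s' s) ?_ (Finset.single_le_sum
        (f := fun t => population ρ t - population ρ t * ∑ s', (T n).avg f s' t)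
        (fun t _ => ?_) (Finset.mem_univ s))
      · rw [mul_sub, mul_one]
      · exact sub_nonneg.2 (mul_le_of_le_one_right (hρ.population_nonneg t)
          ((T n).sum_avg_le_one hf hf1 t))
    rw [mul_comm, ← le_div_iff₀ hs'] at h1
    linarith
  have hlim2 : Tendsto (fun n => ∑ s, (if population ρ s = 0 then 0 else 1) *
      Real.exp (-β * E s) * (1 - (1 - u n) / population ρ s)) atTop
      (𝓝 (∑ s, (if population ρ s = 0 then 0 else 1) *
      Real.exp (-β * E s) * (1 - (1 - 1) / population ρ s))) :=
    tendsto_finsetSum _ fun s _ =>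
      (((hlim.const_sub 1).div_const _).const_sub 1).const_mul _
  have h := le_of_tendsto' hlim2 hb
  simp only [sub_self, zero_div, sub_zero, mul_one] at h
  calc _ ≤ partitionFunction β E' * Real.exp (-β * a) * Real.exp (β * a) :=
        mul_le_mul_of_nonneg_right h (Real.exp_pos _).le
    _ = _ := by rw [mul_assoc, ← Real.exp_add]; simp

lemma singleShotWork_eq (x : S → ℝ) : singleShotWork β E E' x =
    1 / β * (Real.log (partitionFunction β E') - Real.log (supportSum β E x)) := by
  unfold singleShotWork minFreeEnergy supportSum
  ring

lemma mean_le_singleShotWork_add (hβ : 0 < β) {ρ : Matrix S S ℂ} (hρ : IsState ρ)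
    (hd : (dephase E ρ).IsDiag) {c : ℝ} {P : Measure ℝ} (hP : IsBoundedLaw c P)
    (hPa : P ∈ extractionLaws β E E' ρ) :
    ∫ w, w ∂P ≤ singleShotWork β E E' (population ρ) + c := by
  have := hρ.nonempty
  refine le_of_forall_pos_le_add fun δ hδ => ?_
  have h := supportSum_mul_exp_le hβ hρ hd hP hPa hδ
  have hpos : 0 < supportSum β E (population ρ) := hρ.supportSum_pos
  have h2 := Real.log_le_log (mul_pos hpos (Real.exp_pos _)) h
  rw [Real.log_mul hpos.ne' (Real.exp_pos _).ne', Real.log_exp] at h2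
  rw [singleShotWork_eq, one_div, ← sub_le_iff_le_add, ← sub_le_iff_le_add, inv_mul_eq_div,
    le_div_iff₀ hβ]
  linarith

lemma population_mul_exp_le (hβ : 0 < β) {ρ : Matrix S S ℂ} (hρ : IsState ρ)
    {c : ℝ} {P : Measure ℝ} (hP : IsBoundedLaw c P)
    (hPa : P ∈ formationLaws β E E' ρ) {δ : ℝ} (hδ : 0 < δ) (s' : S) :
    population ρ s' * Real.exp (β * E' s') * partitionFunction β E *
      Real.exp (β * ((∫ w, w ∂P) - c - δ)) ≤ 1 := by
  have := hρ.nonempty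
  obtain ⟨T, hT, hfin⟩ := hPa
  obtain ⟨f, hf, hf1, hfa, hfP⟩ := hP.exists_cutoff hδ
  set a := (∫ w, w ∂P) - c - δ with ha
  have hγ := isState_gibbsState (β := β) (E := E)
  have hγd := isDiag_dephase_gibbsState (β := β) (E := E)
  have hZ := partitionFunction_pos (β := β) (E := E)
  have hlim := hT f
  rw [hfP] at hlim
  set u : ℕ → ℝ := fun n => ∑' w, (T n).workProb (gibbsState β E) w * f w with hu
  set γ := population (gibbsState β E) with hγdef
  have hy : Tendsto (fun n => ∑ s, γ s * (T n).avg (fun _ => 1) s' s) atTop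
      (𝓝 (population ρ s')) := by
    have h1 := ((continuous_apply_apply s' s').tendsto (dephase E' ρ)).comp hfin
    have h2 := (Complex.continuous_re.tendsto _).comp h1
    refine (h2.congr fun n => ?_).trans_eq ?_
    · change (dephase E' ((T n).finalState (gibbsState β E)) s' s').re = _
      rw [dephase, Matrix.of_apply, if_pos rfl, (T n).finalState_apply_self hγ.1 hγd,
        Complex.ofReal_re]
    · simp [dephase, population]
  -- The final population of `s'` splits into a part seen by the cutoff, which the second law
  -- controls, and a part that is at most the total missed probability `1 - u n`, which tends to
  -- zero.
  have hb : ∀ n, (∑ s, γ s * (T n).avg (fun _ => 1) s' s) - (1 - u n) ≤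
      Real.exp (-β * (E' s' + a)) / partitionFunction β E := by
    intro n
    have h1 := (T n).second_law_of_le hβ hf hf1 hfa s'
    have h2 : ∑ s, γ s * (T n).avg f s' s ≤
        Real.exp (-β * (E' s' + a)) / partitionFunction β E := by
      rw [le_div_iff₀ hZ, Finset.sum_mul]
      refine le_trans (Finset.sum_le_sum fun s _ => ?_) h1
      rw [hγdef, population_gibbsState, mul_right_comm, div_mul_cancel₀ _ hZ.ne']
    have hu1 : u n = ∑ s, γ s * ∑ s', (T n).avg f s' s :=
      tsum_workProb_eq_sum hγ hγd (T n) hf hf1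
    have h3 : (1 : ℝ) = ∑ s, γ s * ∑ s', (T n).avg (fun _ => 1) s' s := by
      simp_rw [(T n).sum_avg_one, mul_one]
      exact hγ.sum_population.symm
    have h4 : ∑ s, γ s * ((T n).avg (fun _ => 1) s' s - (T n).avg f s' s) ≤ 1 - u n := by
      refine le_of_le_of_eq ?_ (congrArg (· - u n) h3.symm)
      simp only [hu1]
      rw [← Finset.sum_sub_distrib]
      refine Finset.sum_le_sum fun s _ => ?_
      rw [← mul_sub, ← Finset.sum_sub_distrib]
      refine mul_le_mul_of_nonneg_left ?_ (hγ.population_nonneg s)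
      exact Finset.single_le_sum
        (f := fun s' => (T n).avg (fun _ => 1) s' s - (T n).avg f s' s)
        (fun t _ => sub_nonneg.2 ((T n).avg_le_avg_one hf hf1 t s)) (Finset.mem_univ s')
    simp_rw [mul_sub] at h4
    rw [Finset.sum_sub_distrib] at h4
    linarith
  have h := le_of_tendsto' (hy.sub (hlim.const_sub 1)) hb
  rw [sub_self, sub_zero, le_div_iff₀ hZ] at h
  calc _ = population ρ s' * partitionFunction β E * Real.exp (β * (E' s' + a)) := by
        rw [mul_add, Real.exp_add]; ring
    _ ≤ Real.exp (-β * (E' s' + a)) * Real.exp (β * (E' s' + a)) :=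
        mul_le_mul_of_nonneg_right h (Real.exp_pos _).le
    _ = 1 := by rw [← Real.exp_add]; simp

lemma IsState.iSup_population_pos {ρ : Matrix S S ℂ} (hρ : IsState ρ) (E : S → ℝ) :
    0 < ⨆ s, population ρ s * Real.exp (β * E s) := by
  obtain ⟨s, hs⟩ := hρ.exists_population_pos
  exact (mul_pos hs (Real.exp_pos _)).trans_le
    (le_ciSup (f := fun s => population ρ s * Real.exp (β * E s)) (Set.finite_range _).bddAbove s)

lemma singleShotWorkOfFormation_sub_le (hβ : 0 < β) {ρ : Matrix S S ℂ} (hρ : IsState ρ)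
    {c : ℝ} {P : Measure ℝ} (hP : IsBoundedLaw c P) (hPa : P ∈ formationLaws β E E' ρ) :
    singleShotWorkOfFormation β E E' (population ρ) - c ≤ -∫ w, w ∂P := by
  have := hρ.nonempty
  refine le_of_forall_pos_le_add fun δ hδ => ?_
  have hZ := partitionFunction_pos (β := β) (E := E)
  set M := ⨆ s, population ρ s * Real.exp (β * E' s) with hM
  have hMpos : 0 < M := hρ.iSup_population_pos E'
  -- The bound is sharpest at a level that attains the maximum.
  obtain ⟨s', hs'⟩ := exists_eq_ciSup_of_finite (f := fun s => population ρ s * Real.exp (β * E' s))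
  have h := population_mul_exp_le hβ hρ hP hPa hδ s'
  rw [hs', ← hM] at h
  have h2 := Real.log_le_log (by positivity) h
  rw [Real.log_mul (by positivity) (by positivity), Real.log_mul hMpos.ne' hZ.ne', Real.log_exp,
    Real.log_one] at h2
  have h3 : singleShotWorkOfFormation β E E' (population ρ) =
      (Real.log (partitionFunction β E) + Real.log M) / β := by
    unfold singleShotWorkOfFormation maxFreeEnergy
    rw [← hM]
    ring
  rw [h3, sub_le_iff_le_add, div_le_iff₀ hβ]
  linarith

end

/-! ### Thermal operations from permutations of energy levels -/

section

section permutations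

variable {S B : Type*}

lemma orthonormal_ket : Orthonormal ℂ (ket : Label S B → Joint S B) := by
  classical
  rw [orthonormal_iff_ite]
  intro i j
  rw [inner_ket_left, ket, lp.single_apply, Pi.single_apply]

lemma topologicalClosure_span_range_ket :
    (Submodule.span ℂ (Set.range (ket : Label S B → Joint S B))).topologicalClosure = ⊤ := by
  classical
  rw [← (HilbertBasis.ofRepr (LinearIsometryEquiv.refl ℂ (Joint S B))).dense_span]
  congr 3
  funext i
  rw [← HilbertBasis.repr_symm_single, ket]
  rfl

/-- The Hilbert basis of the vectors `|σ i⟩`. -/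
noncomputable def permBasis (σ : Equiv.Perm (Label S B)) :
    HilbertBasis (Label S B) ℂ (Joint S B) :=
  HilbertBasis.mk (v := ket ∘ σ) (orthonormal_ket.comp σ σ.injective) (by
    rw [σ.surjective.range_comp, topologicalClosure_span_range_ket])

/-- The unitary that permutes the basis vectors. -/
noncomputable def permUnitary (σ : Equiv.Perm (Label S B)) : Joint S B ≃ₗᵢ[ℂ] Joint S B :=
  (permBasis σ).repr.symm

lemma permUnitary_ket (σ : Equiv.Perm (Label S B)) (i : Label S B) :
    permUnitary σ (ket i) = ket (σ i) := by
  classical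
  have : ket i = lp.single 2 i (1 : ℂ) := by simp [ket]
  rw [this, permUnitary, HilbertBasis.repr_symm_single, permBasis, HilbertBasis.coe_mk]
  rfl

open Classical in
lemma amp_permUnitary (σ : Equiv.Perm (Label S B)) (j i : Label S B) :
    amp (permUnitary σ) j i = if j = σ i then 1 else 0 := by
  rw [amp, permUnitary_ket]
  exact orthonormal_iff_ite.1 orthonormal_ket j (σ i)

/-- The displacement of the weight when `p` goes to `q`. -/
def displacement (E E' : S → ℝ) (ε : B → ℝ) (q p : S × B) : ℝ :=
  E p.1 + ε p.2 - E' q.1 - ε q.2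

/-- The permutation of the labels that conserves the total energy and extends a permutation of
the joint energy levels of system and bath. -/
def labelPerm (E E' : S → ℝ) (ε : B → ℝ) (π : Equiv.Perm (S × B)) :
    Equiv.Perm (Label S B) where
  toFun i := ((π (i.1, i.2.1)).1, (π (i.1, i.2.1)).2,
    i.2.2 + displacement E E' ε (π (i.1, i.2.1)) (i.1, i.2.1))
  invFun j := ((π.symm (j.1, j.2.1)).1, (π.symm (j.1, j.2.1)).2,
    j.2.2 - displacement E E' ε (j.1, j.2.1) (π.symm (j.1, j.2.1)))
  left_inv i := by simp
  right_inv j := by simp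

lemma eq_labelPerm_iff (E E' : S → ℝ) (ε : B → ℝ) (π : Equiv.Perm (S × B))
    (s' s : S) (b' b : B) (y x : ℝ) :
    (s', b', y) = labelPerm E E' ε π (s, b, x) ↔
      (s', b') = π (s, b) ∧ y = x + displacement E E' ε (π (s, b)) (s, b) := by
  simp only [labelPerm, Equiv.coe_fn_mk, Prod.ext_iff]
  tauto

end permutations

variable {S : Type*} {β : ℝ} {E E' : S → ℝ}

/-- The thermal operation with a finite bath that permutes the joint energy levels of system and
bath. -/
noncomputable def permOperation (β : ℝ) (E E' : S → ℝ) {B : Type} [Fintype B] [Nonempty B]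
    (ε : B → ℝ) (π : Equiv.Perm (S × B)) : ThermalOperation β E E' where
  B := B
  ε := ε
  bath_nonempty := inferInstance
  bath_summable := (hasSum_fintype _).summable
  U := permUnitary (labelPerm E E' ε π)
  energy_conservation j i := by
    classical
    rw [amp_permUnitary]
    split_ifs with h
    · rw [mul_one, one_mul, h]
      congr 1
      simp only [totalEnergy, labelPerm, displacement, Equiv.coe_fn_mk]
      ring
    · simp
  translation_invariance s' s b' b y x a := by
    classical
    rw [amp_permUnitary, amp_permUnitary]
    refine if_congr ?_ rfl rfl
    rw [eq_labelPerm_iff, eq_labelPerm_iff, add_right_comm x a, add_left_inj]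

/-- The Gibbs distribution of a finite bath. -/
noncomputable def gibbsProb {B : Type*} [Fintype B] (β : ℝ) (ε : B → ℝ) (b : B) : ℝ :=
  Real.exp (-β * ε b) / ∑ a, Real.exp (-β * ε a)

lemma gibbsProb_nonneg {B : Type*} [Fintype B] (β : ℝ) (ε : B → ℝ) (b : B) : 0 ≤ gibbsProb β ε b :=
  div_nonneg (Real.exp_pos _).le (Finset.sum_nonneg fun _ _ => (Real.exp_pos _).le)

section

variable {B : Type} [Fintype B] [Nonempty B] (ε : B → ℝ) (π : Equiv.Perm (S × B))

open Classical in
lemma amp_permOperation (s' s : S) (b' b : B) (w : ℝ) :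
    amp (permOperation β E E' ε π).U (s', b', w) (s, b, 0) =
      if (s', b') = π (s, b) ∧ w = displacement E E' ε (π (s, b)) (s, b) then 1 else 0 := by
  refine (amp_permUnitary (labelPerm E E' ε π) (s', b', w) (s, b, 0)).trans ?_
  refine if_congr ?_ rfl rfl
  rw [eq_labelPerm_iff, zero_add]

lemma bathProb_permOperation (b : B) :
    (permOperation β E E' ε π).bathProb b = gibbsProb β ε b := by
  change Real.exp (-β * ε b) / ∑' a : B, Real.exp (-β * ε a) = _
  rw [tsum_fintype, gibbsProb]

open Classical in
lemma kernel_permOperation (s' s : S) (w : ℝ) :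
    (permOperation β E E' ε π).kernel s' s w =
      ∑ b, if w = displacement E E' ε (π (s, b)) (s, b) then
        if (π (s, b)).1 = s' then ENNReal.ofReal (gibbsProb β ε b) else 0 else 0 := by
  unfold ThermalOperation.kernel
  change ∑' p : B × B, ENNReal.ofReal ((permOperation β E E' ε π).bathProb p.1) *
    ‖amp (permOperation β E E' ε π).U (s', p.2, w) (s, p.1, 0)‖ₑ ^ 2 = _
  simp_rw [bathProb_permOperation, amp_permOperation]
  rw [tsum_fintype, Fintype.sum_prod_type]
  refine Finset.sum_congr rfl fun b _ => ?_
  rw [Finset.sum_eq_single (π (s, b)).2]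
  · by_cases h1 : w = displacement E E' ε (π (s, b)) (s, b)
    · by_cases h2 : (π (s, b)).1 = s'
      · rw [if_pos h1, if_pos h2, if_pos ⟨by rw [← h2], h1⟩]
        simp
      · rw [if_pos h1, if_neg h2, if_neg]
        · simp
        · exact fun h' => h2 (by rw [← h'.1])
    · rw [if_neg h1, if_neg fun h' => h1 h'.2]
      simp
  · intro b' _ hb'
    rw [if_neg]
    · simp
    · exact fun h' => hb' (by rw [← h'.1])
  · simp

open Classical in
lemma avg_permOperation (f : ℝ → ℝ) (s' s : S) :
    (permOperation β E E' ε π).avg f s' s =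
      ∑ b, if (π (s, b)).1 = s' then gibbsProb β ε b *
        f (displacement E E' ε (π (s, b)) (s, b)) else 0 := by
  unfold ThermalOperation.avg
  have h : ∀ w, ((permOperation β E E' ε π).kernel s' s w).toReal * f w =
      ∑ b, if w = displacement E E' ε (π (s, b)) (s, b) then
        (if (π (s, b)).1 = s' then gibbsProb β ε b * f w else 0) else 0 := by
    intro w
    rw [kernel_permOperation, ENNReal.toReal_sum, Finset.sum_mul]
    · refine Finset.sum_congr rfl fun b _ => ?_
      split_ifs
      · rw [ENNReal.toReal_ofReal (gibbsProb_nonneg β ε b)]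
      all_goals simp
    · intro b _
      split_ifs <;> simp
  simp_rw [h]
  rw [Summable.tsum_finsetSum]
  · refine Finset.sum_congr rfl fun b _ => ?_
    rw [tsum_ite_eq]
  · intro b _
    exact summable_of_ne_finset_zero (s := {displacement E E' ε (π (s, b)) (s, b)}) fun w hw =>
      if_neg (by simpa using hw)

/-- Each basis vector is sent to a single basis vector and the Gibbs state is diagonal, so no
coherence arises, not even within a degenerate level. -/
lemma finalState_permOperation_apply_ne [Fintype S] {s' t' : S} (h : s' ≠ t') :
    (permOperation β E E' ε π).finalState (gibbsState β E) s' t' = 0 := by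
  classical
  have hterm : ∀ (w : ℝ) (b b' : B) (s t : S),
      ((permOperation β E E' ε π).bathProb b : ℂ) * gibbsState β E s t *
        amp (permOperation β E E' ε π).U (s', b', w) (s, b, 0) *
        (starRingEnd ℂ) (amp (permOperation β E E' ε π).U (t', b', w) (t, b, 0)) = 0 := by
    intro w b b' s t
    by_cases hst : s = t
    · subst hst
      simp only [amp_permOperation]
      by_cases h1 : (s', b') = π (s, b) ∧ w = displacement E E' ε (π (s, b)) (s, b)
      · rw [if_neg (fun h2 : (t', b') = _ ∧ _ => h (Prod.ext_iff.1 (h1.1.trans h2.1.symm)).1)]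
        simp
      · rw [if_neg h1]
        simp
    · simp [gibbsState, Matrix.diagonal_apply_ne _ hst]
  simp only [ThermalOperation.finalState, ThermalOperation.outcome, Matrix.of_apply]
  refine (tsum_congr fun w => ?_).trans tsum_zero
  refine (tsum_congr fun p => ?_).trans tsum_zero
  exact Finset.sum_eq_zero fun s _ => Finset.sum_eq_zero fun t _ => hterm w p.1 p.2 s t

end

end

/-! ### Matching levels on a ladder with geometric degeneracy -/

section

/-- A partial key `κ` and a key `κ'` such that no key is asked for by `κ` more often than it is
available in `κ'` are matched by a permutation. -/
lemma exists_perm_of_card_fiber_le {α C : Type*} [Fintype α] [DecidableEq C] (κ : α → Option C)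
    (κ' : α → C) (h : ∀ z ∈ Set.range κ', (Finset.univ.filter fun a => κ a = some z).card ≤
      (Finset.univ.filter fun a => κ' a = z).card) :
    ∃ π : Equiv.Perm α, ∀ a z, κ a = some z → z ∈ Set.range κ' → κ' (π a) = z := by
  classical
  have hne : ∀ z : Set.range κ', Nonempty ({a // κ a = some z.1} ↪ {a // κ' a = z.1}) := by
    intro z
    refine Function.Embedding.nonempty_of_card_le ?_
    rw [Fintype.card_subtype, Fintype.card_subtype]
    exact h z z.2
  let g := fun z => (hne z).some
  -- Fibres of `κ'` over different keys are disjoint, so the fibrewise embeddings glue to one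
  -- injection, which a finite type extends to a permutation.
  have hinj : ∀ (a b : α) (z z' : Set.range κ') (ha : κ a = some z.1) (hb : κ b = some z'.1),
      (g z ⟨a, ha⟩ : α) = g z' ⟨b, hb⟩ → a = b := by
    intro a b z z' ha hb hab
    have hz : z = z' := Subtype.ext (by rw [← (g z ⟨a, ha⟩).2, hab, (g z' ⟨b, hb⟩).2])
    subst hz
    exact congrArg Subtype.val ((g z).injective (Subtype.ext hab))
  let X : α → Prop := fun a => ∃ z : Set.range κ', κ a = some z.1
  let F : {a // X a} → α := fun a => g a.2.choose ⟨a.1, a.2.choose_spec⟩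
  have hF : Function.Injective F := fun a b hab => Subtype.ext (hinj _ _ _ _ _ _ hab)
  refine ⟨(Equiv.ofInjective F hF).extendSubtype, fun a z ha hz => ?_⟩
  have hX : X a := ⟨⟨z, hz⟩, ha⟩
  rw [Equiv.extendSubtype_apply_of_mem _ a hX, Equiv.ofInjective_apply]
  have h1 : κ' (F ⟨a, hX⟩) = hX.choose.1 := (g hX.choose ⟨a, hX.choose_spec⟩).2
  rw [h1]
  exact Option.some_injective _ (hX.choose_spec.symm.trans ha)

/-- The register `Fin Q` of the bath serves as a source of randomness: its value selects the final
level, and `none` absorbs the rounding loss. -/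
lemma exists_fiber_card_eq {S : Type*} [Fintype S] [DecidableEq S] (c : S → ℕ) {Q : ℕ}
    (h : ∑ s, c s ≤ Q) :
    ∃ f : Fin Q → Option S, ∀ s, (Finset.univ.filter fun q => f q = some s).card = c s := by
  classical
  have hcard : Fintype.card ((Σ s, Fin (c s)) ⊕ Fin (Q - ∑ s, c s)) = Q := by
    simp [h]
  let e := Fintype.equivFinOfCardEq hcard
  refine ⟨fun q => Sum.elim (fun x => some x.1) (fun _ => none) (e.symm q), fun s => ?_⟩
  rw [← Fintype.card_subtype, ← Fintype.card_fin (c s)]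
  refine Fintype.card_congr (Equiv.ofBijective
    (fun i : Fin (c s) => (⟨e (Sum.inl ⟨s, i⟩), by simp⟩ : {q // _})) ⟨?_, ?_⟩).symm
  · intro i j hij
    simpa using hij
  · rintro ⟨q, hq⟩
    obtain ⟨x, rfl⟩ := e.surjective q
    rcases x with ⟨t, i⟩ | x
    · simp only [Equiv.symm_apply_apply, Sum.elim_inl, Option.some.injEq] at hq
      subst hq
      exact ⟨i, rfl⟩
    · simp at hq

/-- The levels of a bath whose degeneracy increases geometrically with the energy. -/
abbrev Ladder (m Q N : ℕ) := Fin Q × (k : Fin (N + 1)) × Fin ((m + 1) ^ k.1 * m ^ (N - k.1))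

section ladder

variable {m Q N : ℕ}

lemma degeneracy_eq (hm : 0 < m) (k : Fin (N + 1)) :
    (((m + 1) ^ k.1 * m ^ (N - k.1) : ℕ) : ℝ) = m ^ N * (((m : ℝ) + 1) / m) ^ (k.1 : ℤ) := by
  have hm' : (m : ℝ) ≠ 0 := by exact_mod_cast hm.ne'
  have hk : k.1 ≤ N := Nat.lt_succ_iff.1 k.2
  push_cast
  rw [zpow_natCast, div_pow, ← pow_sub_mul_pow (m : ℝ) hk]
  field_simp

lemma sum_ladder (hm : 0 < m) (φ : Fin Q → Fin (N + 1) → ℝ) :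
    ∑ b : Ladder m Q N, φ b.1 b.2.1 =
      ∑ q, ∑ k : Fin (N + 1), m ^ N * (((m : ℝ) + 1) / m) ^ (k.1 : ℤ) * φ q k := by
  rw [Fintype.sum_prod_type]
  refine Finset.sum_congr rfl fun q _ => ?_
  rw [Fintype.sum_sigma]
  refine Finset.sum_congr rfl fun k _ => ?_
  dsimp only
  rw [Finset.sum_const, Finset.card_univ, Fintype.card_fin, nsmul_eq_mul, degeneracy_eq hm]

/-- Only an inequality, because a shifted rung `k` may lie off the ladder, where the left side is
zero. -/
lemma sum_filter_level_le (k : ℤ) (hm : 0 < m) (p : Fin Q → Prop) [DecidablePred p] :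
    ∑ b : Ladder m Q N, (if p b.1 ∧ (b.2.1.1 : ℤ) = k then (1 : ℝ) else 0) ≤
      (Finset.univ.filter p).card * (m ^ N * (((m : ℝ) + 1) / m) ^ k) := by
  rw [sum_ladder hm fun q l => if p q ∧ (l.1 : ℤ) = k then (1 : ℝ) else 0,
    Finset.card_filter, Nat.cast_sum, Finset.sum_mul]
  refine Finset.sum_le_sum fun q _ => ?_
  by_cases hq : p q
  · simp only [hq, true_and, if_true, Nat.cast_one, one_mul, mul_ite, mul_one, mul_zero]
    by_cases hk : ∃ l : Fin (N + 1), (l.1 : ℤ) = k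
    · obtain ⟨l, rfl⟩ := hk
      simp only [Nat.cast_inj, Fin.val_inj]
      simp
    · rw [Finset.sum_eq_zero]
      · positivity
      · exact fun l _ => if_neg fun h => hk ⟨l, h⟩
  · simp [hq]

lemma sum_filter_level_eq (hm : 0 < m) (l : Fin (N + 1)) :
    ∑ b : Ladder m Q N, (if (b.2.1.1 : ℤ) = (l.1 : ℤ) then (1 : ℝ) else 0) =
      Q * (m ^ N * (((m : ℝ) + 1) / m) ^ (l.1 : ℤ)) := by
  rw [sum_ladder hm fun _ k => if (k.1 : ℤ) = (l.1 : ℤ) then (1 : ℝ) else 0]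
  simp only [Nat.cast_inj, Fin.val_inj]
  simp

variable {S : Type*} [Fintype S]

/-- If the second law holds for the discretised energies, there is a permutation of the joint
levels of system and ladder that implements the transitions `f` up to boundary effects. -/
lemma exists_perm_ladder (N : ℕ) (hm : 0 < m) (f : Fin Q → Option S) (D : Finset S)
    [DecidableEq S] (e e' : S → ℤ) (ω : ℤ)
    (h : ∀ s', ((Finset.univ.filter fun q => f q = some s').card : ℝ) *
      ∑ s ∈ D, (((m : ℝ) + 1) / m) ^ (ω + e' s' - e s) ≤ Q) :
    ∃ π : Equiv.Perm (S × Ladder m Q N), ∀ s ∈ D, ∀ (b : Ladder m Q N) (s' : S),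
      f b.1 = some s' → 0 ≤ (b.2.1.1 : ℤ) + (e s - ω - e' s') →
      (b.2.1.1 : ℤ) + (e s - ω - e' s') ≤ N →
      (π (s, b)).1 = s' ∧ ((π (s, b)).2.2.1.1 : ℤ) = b.2.1.1 + (e s - ω - e' s') := by
  have hm' : (m : ℝ) ≠ 0 := by exact_mod_cast hm.ne'
  have hr : ((m : ℝ) + 1) / m ≠ 0 := by positivity
  -- The key is the target level and rung fixed by discretised energy balance with work `ω`; `κ'`
  -- reads off the actual level and rung.
  let κ : S × Ladder m Q N → Option (S × ℤ) := fun p =>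
    if p.1 ∈ D then (f p.2.1).map fun s' => (s', (p.2.2.1.1 : ℤ) + (e p.1 - ω - e' s')) else none
  let κ' : S × Ladder m Q N → S × ℤ := fun p => (p.1, (p.2.2.1.1 : ℤ))
  have hκ : ∀ (s : S) (b : Ladder m Q N) (s' : S) (k : ℤ), κ (s, b) = some (s', k) ↔
      s ∈ D ∧ f b.1 = some s' ∧ (b.2.1.1 : ℤ) = k + (ω + e' s' - e s) := by
    intro s b s' k
    simp only [κ]
    split_ifs with hs
    · simp only [Option.map_eq_some_iff, Prod.mk.injEq, hs, true_and]
      constructor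
      · rintro ⟨t, ht, rfl, h2⟩
        exact ⟨ht, by linarith⟩
      · rintro ⟨h1, h2⟩
        exact ⟨s', h1, rfl, by linarith⟩
    · simp [hs]
  obtain ⟨π, hπ⟩ := exists_perm_of_card_fiber_le κ κ' (by
    rintro z ⟨⟨s', b'⟩, rfl⟩
    simp only [κ']
    rw [← Nat.cast_le (α := ℝ), Finset.card_filter, Finset.card_filter, Nat.cast_sum,
      Nat.cast_sum, Fintype.sum_prod_type, Fintype.sum_prod_type]
    simp only [hκ, Prod.mk.injEq, Nat.cast_ite, Nat.cast_one, Nat.cast_zero]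
    calc _ ≤ ∑ s, if s ∈ D then ((Finset.univ.filter fun q => f q = some s').card : ℝ) *
            (m ^ N * (((m : ℝ) + 1) / m) ^ ((b'.2.1.1 : ℤ) + (ω + e' s' - e s))) else 0 := by
          refine Finset.sum_le_sum fun s _ => ?_
          by_cases hs : s ∈ D
          · simp only [hs, true_and, if_true]
            exact sum_filter_level_le _ hm fun q => f q = some s'
          · simp [hs]
      -- Geometric degeneracy lets the rung factor out, so one condition per `s'` serves all rungs.
      _ = m ^ N * (((m : ℝ) + 1) / m) ^ (b'.2.1.1 : ℤ) *
            (((Finset.univ.filter fun q => f q = some s').card : ℝ) *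
            ∑ s ∈ D, (((m : ℝ) + 1) / m) ^ (ω + e' s' - e s)) := by
          rw [Finset.sum_ite_mem, Finset.univ_inter, Finset.mul_sum, Finset.mul_sum]
          refine Finset.sum_congr rfl fun s _ => ?_
          rw [zpow_add₀ hr]
          ring
      _ ≤ m ^ N * (((m : ℝ) + 1) / m) ^ (b'.2.1.1 : ℤ) * Q :=
          mul_le_mul_of_nonneg_left (h s') (by positivity)
      _ = _ := by
          rw [Finset.sum_eq_single s']
          · simp only [true_and]
            rw [sum_filter_level_eq hm b'.2.1]
            ring
          · intro t _ ht
            simp [ht]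
          · simp)
  refine ⟨π, fun s hs b s' hf h0 hN => ?_⟩
  have hz : κ (s, b) = some (s', (b.2.1.1 : ℤ) + (e s - ω - e' s')) :=
    (hκ _ _ _ _).2 ⟨hs, hf, by ring⟩
  have hrange : (s', (b.2.1.1 : ℤ) + (e s - ω - e' s')) ∈ Set.range κ' := by
    obtain ⟨k, hk⟩ := Int.eq_ofNat_of_zero_le h0
    have hkN : k < N + 1 := by omega
    refine ⟨(s', b.1, ⟨⟨k, hkN⟩, ⟨0, by positivity⟩⟩), ?_⟩
    simp only [κ', hk]
  simpa [κ', Prod.ext_iff] using hπ _ _ hz hrange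

end ladder

end

/-! ### Gibbs weights of the ladder and boundary effects -/

section

section

variable {m Q N : ℕ} {β : ℝ}

/-- The spacing of the energies of the ladder. -/
noncomputable def ladderGap (β : ℝ) (m : ℕ) : ℝ := Real.log (((m : ℝ) + 1) / m) / β

lemma exp_mul_ladderGap (hβ : 0 < β) (hm : 0 < m) (k : ℤ) :
    Real.exp (β * (ladderGap β m * k)) = (((m : ℝ) + 1) / m) ^ k := by
  have hr : 0 < ((m : ℝ) + 1) / m := by positivity
  rw [ladderGap, ← Real.rpow_intCast, Real.rpow_def_of_pos hr]
  congr 1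
  field_simp

lemma ladderGap_pos (hβ : 0 < β) (hm : 0 < m) : 0 < ladderGap β m := by
  refine div_pos (Real.log_pos ?_) hβ
  have : (0 : ℝ) < m := by exact_mod_cast hm
  rw [lt_div_iff₀ this]
  linarith

/-- The gap is chosen such that the Boltzmann factor cancels the growth of the degeneracy; each of
the `Q * (N + 1)` pairs of register value and rung then has the same total weight. -/
lemma gibbsProb_ladder (hβ : 0 < β) (hm : 0 < m) (b : Ladder m Q N) :
    gibbsProb β (fun b : Ladder m Q N => ladderGap β m * (b.2.1.1 : ℤ)) b =
      (((m : ℝ) + 1) / m) ^ (-(b.2.1.1 : ℤ)) / (Q * (N + 1) * m ^ N) := by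
  have hr : ((m : ℝ) + 1) / m ≠ 0 := by positivity
  have h : ∀ k : ℤ, Real.exp (-β * (ladderGap β m * k)) = (((m : ℝ) + 1) / m) ^ (-k) := by
    intro k
    rw [← exp_mul_ladderGap hβ hm]
    congr 1
    push_cast
    ring
  unfold gibbsProb
  simp_rw [h]
  rw [sum_ladder hm fun _ k => (((m : ℝ) + 1) / m) ^ (-(k.1 : ℤ))]
  congr 1
  have h2 : ∀ k : Fin (N + 1), (m : ℝ) ^ N * (((m : ℝ) + 1) / m) ^ (k.1 : ℤ) *
      (((m : ℝ) + 1) / m) ^ (-(k.1 : ℤ)) = m ^ N := by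
    intro k
    rw [mul_assoc, ← zpow_add₀ hr, add_neg_cancel, zpow_zero, mul_one]
  simp_rw [h2]
  simp
  ring

lemma sum_ite_interior_ge (N a : ℕ) :
    (N : ℝ) + 1 - 2 * a ≤
      ∑ k : Fin (N + 1), if a ≤ k.1 ∧ k.1 + a ≤ N then (1 : ℝ) else 0 := by
  rw [Fin.sum_univ_eq_sum_range (fun k => if a ≤ k ∧ k + a ≤ N then (1 : ℝ) else 0),
    ← Finset.sum_filter, Finset.sum_const, nsmul_eq_mul, mul_one]
  have hsub : Finset.Ico a (N + 1 - a) ⊆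
      (Finset.range (N + 1)).filter fun k => a ≤ k ∧ k + a ≤ N := by
    intro k hk
    simp only [Finset.mem_Ico, Finset.mem_filter, Finset.mem_range] at hk ⊢
    omega
  have hc := Finset.card_le_card hsub
  rw [Nat.card_Ico] at hc
  have h2 : N + 1 ≤ ((Finset.range (N + 1)).filter fun k => a ≤ k ∧ k + a ≤ N).card + 2 * a := by
    omega
  have h3 : ((N + 1 : ℕ) : ℝ) ≤
      ((((Finset.range (N + 1)).filter fun k => a ≤ k ∧ k + a ≤ N).card + 2 * a : ℕ) : ℝ) := by
    exact_mod_cast h2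
  push_cast at h3
  linarith

/-- As rungs are equally likely, excluding `a` rungs at either end costs at most a fraction `2 * a /
(N + 1)`. -/
lemma sum_gibbsProb_ladder_ge (hβ : 0 < β) (hm : 0 < m) (hQ : 0 < Q) (p : Fin Q → Prop)
    [DecidablePred p] (a : ℕ) :
    ((Finset.univ.filter p).card : ℝ) / Q * (1 - 2 * a / (N + 1)) ≤
      ∑ b : Ladder m Q N, if p b.1 ∧ a ≤ b.2.1.1 ∧ b.2.1.1 + a ≤ N then
        gibbsProb β (fun b : Ladder m Q N => ladderGap β m * (b.2.1.1 : ℤ)) b else 0 := by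
  have hr : ((m : ℝ) + 1) / m ≠ 0 := by positivity
  have hm0 : (m : ℝ) ≠ 0 := by exact_mod_cast hm.ne'
  have hQ0 : (0 : ℝ) < Q := by exact_mod_cast hQ
  simp_rw [gibbsProb_ladder hβ hm]
  rw [sum_ladder hm fun q k => if p q ∧ a ≤ k.1 ∧ k.1 + a ≤ N then
    (((m : ℝ) + 1) / m) ^ (-(k.1 : ℤ)) / (Q * (N + 1) * m ^ N) else 0]
  have h : ∀ (q : Fin Q) (k : Fin (N + 1)), (m : ℝ) ^ N * (((m : ℝ) + 1) / m) ^ (k.1 : ℤ) *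
      (if p q ∧ a ≤ k.1 ∧ k.1 + a ≤ N then
      (((m : ℝ) + 1) / m) ^ (-(k.1 : ℤ)) / (Q * (N + 1) * m ^ N) else 0) =
      (if p q then 1 else 0) * (1 / (Q * (N + 1)) *
        (if a ≤ k.1 ∧ k.1 + a ≤ N then 1 else 0)) := by
    intro q k
    by_cases h1 : p q <;> by_cases h2 : a ≤ k.1 ∧ k.1 + a ≤ N
    · rw [if_pos ⟨h1, h2⟩, if_pos h1, if_pos h2, zpow_neg]
      have := zpow_ne_zero (k.1 : ℤ) hr
      field_simp
    all_goals simp [h1, h2]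
  simp_rw [h, ← Finset.mul_sum]
  rw [← Finset.sum_mul, Finset.card_filter, Nat.cast_sum]
  simp only [Nat.cast_ite, Nat.cast_one, Nat.cast_zero]
  rw [div_mul_eq_mul_div, mul_div_assoc]
  refine mul_le_mul_of_nonneg_left ?_ (Finset.sum_nonneg fun q _ => by split_ifs <;> norm_num)
  calc _ = 1 / (Q * (N + 1)) * ((N : ℝ) + 1 - 2 * a) := by field_simp
    _ ≤ _ := mul_le_mul_of_nonneg_left (sum_ite_interior_ge N a) (by positivity)

end

variable {S : Type*} [Fintype S] {β : ℝ} {E E' : S → ℝ}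

/-- Transitions that are independent of the initial level and obey the second law at the
resolution of a ladder are implemented by a thermal operation, up to boundary effects. -/
lemma exists_operation_of_ladder (hβ : 0 < β) {m Q : ℕ} (N : ℕ) (hm : 0 < m) (hQ : 0 < Q)
    (D : Finset S) (c : S → ℕ) (hc : ∑ s, c s ≤ Q) (e e' : S → ℤ) (ω : ℤ)
    (hE : ∀ s, |E s - ladderGap β m * e s - ladderGap β m / 2| ≤ ladderGap β m / 2)
    (hE' : ∀ s, |E' s - ladderGap β m * e' s - ladderGap β m / 2| ≤ ladderGap β m / 2)
    (h : ∀ s', (c s' : ℝ) * ∑ s ∈ D, Real.exp (β * (ladderGap β m * (ω + e' s' - e s))) ≤ Q) :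
    ∃ T : ThermalOperation β E E',
      (∀ s' t', s' ≠ t' → T.finalState (gibbsState β E) s' t' = 0) ∧
      ∀ f : ℝ → ℝ, (∀ w, 0 ≤ f w) →
        (∀ w, |w - ladderGap β m * ω| ≤ ladderGap β m → f w = 1) → ∀ s ∈ D, ∀ s',
        (c s' : ℝ) / Q * (1 - 2 * (e s - ω - e' s').natAbs / (N + 1)) ≤ T.avg f s' s := by
  classical
  obtain ⟨f, hf⟩ := exists_fiber_card_eq c hc
  have h' : ∀ s', ((Finset.univ.filter fun q => f q = some s').card : ℝ) *
      ∑ s ∈ D, (((m : ℝ) + 1) / m) ^ (ω + e' s' - e s) ≤ Q := by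
    intro s'
    rw [hf]
    convert h s' using 4 with s _
    rw [← exp_mul_ladderGap hβ hm]
    push_cast
    rfl
  obtain ⟨π, hπ⟩ := exists_perm_ladder N hm f D e e' ω h'
  have : Nonempty (Ladder m Q N) := ⟨(⟨0, hQ⟩, ⟨0, ⟨0, by positivity⟩⟩)⟩
  refine ⟨permOperation β E E' (fun b : Ladder m Q N => ladderGap β m * (b.2.1.1 : ℤ)) π,
    fun s' t' hst => finalState_permOperation_apply_ne _ _ hst, ?_⟩
  intro g hg hg1 s hs s'
  rw [avg_permOperation, ← hf s']
  refine (sum_gibbsProb_ladder_ge hβ hm hQ (fun q => f q = some s') _).trans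
    (Finset.sum_le_sum fun b _ => ?_)
  have hb := gibbsProb_nonneg β (fun b : Ladder m Q N => ladderGap β m * (b.2.1.1 : ℤ)) b
  by_cases h1 : f b.1 = some s' ∧ (e s - ω - e' s').natAbs ≤ b.2.1.1 ∧
      b.2.1.1 + (e s - ω - e' s').natAbs ≤ N
  · obtain ⟨h2, h3⟩ := hπ s hs b s' h1.1 (by omega) (by omega)
    rw [if_pos h1, if_pos h2, hg1, mul_one]
    simp only [displacement, h2, h3]
    push_cast
    -- Both rounding errors lie between `0` and one gap, so their difference displaces the work by
    -- at most one gap from `ladderGap β m * ω`.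
    have e1 := abs_le.1 (hE s)
    have e2 := abs_le.1 (hE' s')
    rw [abs_le]
    constructor <;> nlinarith
  · rw [if_neg h1]
    split_ifs
    · exact mul_nonneg hb (hg _)
    · exact le_rfl

end

/-! ### Attaining deterministic work in the limit -/

section

lemma tendsto_ladderGap (β : ℝ) : Tendsto (ladderGap β) atTop (𝓝 0) := by
  have h1 : Tendsto (fun m : ℕ => ((m : ℝ) + 1) / m) atTop (𝓝 1) := by
    have h := (tendsto_one_div_atTop_nhds_zero_nat (𝕜 := ℝ)).const_add 1
    rw [add_zero] at h
    refine h.congr' ?_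
    filter_upwards [eventually_gt_atTop 0] with m hm
    have : (m : ℝ) ≠ 0 := by exact_mod_cast hm.ne'
    field_simp
  have h2 := ((Real.continuousAt_log one_ne_zero).tendsto.comp h1).div_const β
  rw [Real.log_one, zero_div] at h2
  exact h2

variable {S : Type*} [Fintype S] {β : ℝ} {E E' : S → ℝ}

/-- The strict inequality leaves room for rounding energies to multiples of the gap. Parameters are
chosen in the order `m` (gap), `Q` (resolution of `y`), `N` (length of the ladder). -/
lemma exists_operation_near (hβ : 0 < β) (D : Finset S) {y : S → ℝ} (hy : ∀ s, 0 ≤ y s)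
    (hy1 : ∑ s, y s = 1) {w₁ : ℝ}
    (h : ∀ s', y s' * ∑ s ∈ D, Real.exp (β * (w₁ + E' s' - E s)) < 1) {δ : ℝ} (hδ : 0 < δ) :
    ∃ T : ThermalOperation β E E',
      (∀ s' t', s' ≠ t' → T.finalState (gibbsState β E) s' t' = 0) ∧
      ∀ f : ℝ → ℝ, (∀ w, 0 ≤ f w) → (∀ w, |w - w₁| ≤ δ → f w = 1) → ∀ s ∈ D, ∀ s',
        y s' - δ ≤ T.avg f s' s := by
  have hgap := tendsto_ladderGap β
  have hcond : ∀ᶠ m : ℕ in atTop, ∀ s',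
      y s' * ∑ s ∈ D, Real.exp (β * (w₁ + E' s' - E s + ladderGap β m)) < 1 := by
    rw [eventually_all]
    intro s'
    have hc : Continuous fun x : ℝ =>
        y s' * ∑ s ∈ D, Real.exp (β * (w₁ + E' s' - E s + x)) := by fun_prop
    have ht := (hc.tendsto 0).comp hgap
    simp only [add_zero] at ht
    exact ht.eventually (gt_mem_nhds (h s'))
  -- The gap is below `δ / 2` because the work is off by up to two gaps: one from rounding `w₁`, one
  -- from rounding the system energies.
  obtain ⟨m, ⟨hm, hcm⟩, hmδ⟩ := ((eventually_gt_atTop 0).and hcond |>.and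
    (hgap.eventually (gt_mem_nhds (half_pos hδ)))).exists
  set η := ladderGap β m with hη
  have hηpos : 0 < η := ladderGap_pos hβ hm
  -- Rounding `Q * y s` down costs less than `1 / Q < δ / 2`; the other half of `δ` is left for the
  -- ends of the ladder.
  obtain ⟨Q, hQδ⟩ := exists_nat_gt (2 / δ)
  have hQ' : (0 : ℝ) < Q := (div_pos two_pos hδ).trans hQδ
  have hQ : 0 < Q := by exact_mod_cast hQ'
  have hfloor : ∀ x : ℝ, η * ⌊x / η⌋ ≤ x ∧ x ≤ η * ⌊x / η⌋ + η := by
    intro x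
    have h1 := Int.floor_le (x / η)
    have h2 := (Int.lt_floor_add_one (x / η)).le
    rw [le_div_iff₀ hηpos] at h1
    rw [div_le_iff₀ hηpos] at h2
    constructor <;> linarith
  have hfloor' : ∀ x : ℝ, |x - η * ⌊x / η⌋ - η / 2| ≤ η / 2 := by
    intro x
    rw [abs_le]
    constructor <;> linarith [(hfloor x).1, (hfloor x).2]
  set ω : ℤ := ⌊w₁ / η⌋ with hω
  let c : S → ℕ := fun s => ⌊Q * y s⌋₊
  have hcle : ∀ s, (c s : ℝ) ≤ Q * y s := fun s =>
    Nat.floor_le (mul_nonneg hQ'.le (hy s))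
  have hcsum : ∑ s, c s ≤ Q := by
    have : ∑ s, (c s : ℝ) ≤ Q := by
      refine (Finset.sum_le_sum fun s _ => hcle s).trans_eq ?_
      rw [← Finset.mul_sum, hy1, mul_one]
    exact_mod_cast this
  have hN : ∀ᶠ N : ℕ in atTop, ∀ s s' : S,
      2 * ((⌊E s / η⌋ - ω - ⌊E' s' / η⌋).natAbs : ℝ) / (N + 1) < δ / 2 := by
    rw [eventually_all]
    intro s
    rw [eventually_all]
    intro s'
    have ht : Tendsto (fun N : ℕ => 2 * ((⌊E s / η⌋ - ω - ⌊E' s' / η⌋).natAbs : ℝ) / ((N : ℝ) + 1))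
        atTop (𝓝 0) :=
      tendsto_const_nhds.div_atTop (tendsto_atTop_add_const_right _ _ tendsto_natCast_atTop_atTop)
    exact ht.eventually (gt_mem_nhds (half_pos hδ))
  obtain ⟨N, hN⟩ := hN.exists
  obtain ⟨T, hT, hT'⟩ := exists_operation_of_ladder (E := E) (E' := E') hβ N hm hQ D c hcsum
    (fun s => ⌊E s / η⌋) (fun s => ⌊E' s / η⌋) ω (fun s => hfloor' (E s))
    (fun s => hfloor' (E' s)) (fun s' => by
      calc _ ≤ (Q * y s') * ∑ s ∈ D, Real.exp (β * (w₁ + E' s' - E s + η)) := by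
            refine mul_le_mul (hcle s') (Finset.sum_le_sum fun s _ => ?_)
              (Finset.sum_nonneg fun _ _ => (Real.exp_pos _).le) (mul_nonneg hQ'.le (hy s'))
            refine Real.exp_le_exp.2 (mul_le_mul_of_nonneg_left ?_ hβ.le)
            linarith [(hfloor w₁).1, (hfloor (E' s')).1, (hfloor (E s)).2]
        _ ≤ Q := by
            rw [mul_assoc]
            exact mul_le_of_le_one_right hQ'.le (hcm s').le)
  refine ⟨T, hT, fun f hf hf1 s hs s' => ?_⟩
  refine le_trans ?_ (hT' f hf (fun w hw => hf1 w ?_) s hs s')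
  · have h1 : y s' - δ / 2 ≤ (c s' : ℝ) / Q := by
      rw [le_div_iff₀ hQ']
      have h2 : (Q : ℝ) * y s' < c s' + 1 := Nat.lt_floor_add_one _
      rw [div_lt_iff₀ hδ] at hQδ
      linarith
    have h2 : (c s' : ℝ) / Q ≤ 1 := by
      rw [div_le_one hQ']
      exact_mod_cast (Finset.single_le_sum (fun _ _ => Nat.zero_le _) (Finset.mem_univ s')).trans
        hcsum
    have h3 := hN s s'
    have h4 : 0 ≤ 2 * ((⌊E s / η⌋ - ω - ⌊E' s' / η⌋).natAbs : ℝ) / (N + 1) := by positivity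
    have h5 := mul_le_of_le_one_left h4 h2
    rw [mul_sub, mul_one]
    linarith
  · have h1 := abs_le.1 hw
    rw [abs_le]
    constructor <;> linarith [(hfloor w₁).1, (hfloor w₁).2]

/-- The indicator function of a window around `w₁`. -/
noncomputable def window (w₁ δ w : ℝ) : ℝ := if |w - w₁| ≤ δ then 1 else 0

lemma window_nonneg (w₁ δ w : ℝ) : 0 ≤ window w₁ δ w := by
  unfold window; split_ifs <;> norm_num

lemma window_le_one (w₁ δ w : ℝ) : window w₁ δ w ≤ 1 := by
  unfold window; split_ifs <;> norm_num

lemma window_eq_one {w₁ δ w : ℝ} (h : |w - w₁| ≤ δ) : window w₁ δ w = 1 := if_pos h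

section weakLimit

variable {ρ : Matrix S S ℂ} (hρ : IsState ρ) (hd : (dephase E ρ).IsDiag)
  (T : ThermalOperation β E E')

include hρ hd

lemma workProb_nonneg (w : ℝ) : 0 ≤ T.workProb ρ w := by
  rw [T.workProb_eq hρ.1 hd]
  exact Finset.sum_nonneg fun s _ => mul_nonneg (hρ.population_nonneg s)
    (Finset.sum_nonneg fun _ _ => ENNReal.toReal_nonneg)

lemma summable_workProb : Summable (T.workProb ρ) := by
  simp_rw [funext (T.workProb_eq hρ.1 hd)]
  exact summable_sum fun s _ => (summable_sum fun s' _ => T.summable_kernel s' s).mul_left _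

lemma tsum_workProb : ∑' w, T.workProb ρ w = 1 := by
  have h := tsum_workProb_eq_sum hρ hd T (f := fun _ => 1) (by simp) (by simp)
  simpa [T.sum_avg_one, hρ.sum_population] using h

/-- Inside the window `f` varies by at most `ε`; outside, the difference is at most `2 * ‖f‖`,
weighted by the probability of leaving the window. -/
lemma abs_tsum_workProb_mul_sub_le (f : BoundedContinuousFunction ℝ ℝ) {w₁ δ ε : ℝ}
    (hε : ∀ w, |w - w₁| ≤ δ → |f w - f w₁| ≤ ε) (hε0 : 0 ≤ ε) :
    |∑' w, T.workProb ρ w * f w - f w₁| ≤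
      ε + 2 * ‖f‖ * (1 - ∑' w, T.workProb ρ w * window w₁ δ w) := by
  have hp := workProb_nonneg hρ hd T
  have hs := summable_workProb hρ hd T
  have h1 := tsum_workProb hρ hd T
  have hbdd : ∀ {g : ℝ → ℝ} {C : ℝ}, (∀ w, |g w| ≤ C) →
      Summable fun w => T.workProb ρ w * g w := by
    intro g C hg
    refine Summable.of_norm_bounded (hs.mul_right C) fun w => ?_
    rw [norm_mul, Real.norm_of_nonneg (hp w)]
    exact mul_le_mul_of_nonneg_left (hg w) (hp w)
  have hsf : Summable fun w => T.workProb ρ w * f w := hbdd fun w => f.norm_coe_le_norm w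
  have hsw : Summable fun w => T.workProb ρ w * window w₁ δ w :=
    hbdd (C := 1) fun w => abs_le.2 ⟨by linarith [window_nonneg w₁ δ w], window_le_one w₁ δ w⟩
  have hpt : ∀ w, |f w - f w₁| ≤ ε + 2 * ‖f‖ * (1 - window w₁ δ w) := by
    intro w
    by_cases hw : |w - w₁| ≤ δ
    · rw [window_eq_one hw]
      linarith [hε w hw]
    · rw [window, if_neg hw]
      have h2 := f.norm_coe_le_norm w
      have h3 := f.norm_coe_le_norm w₁
      have h4 := norm_sub_le (f w) (f w₁)
      rw [Real.norm_eq_abs (f w - f w₁)] at h4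
      linarith
  have hl : ∑' w, T.workProb ρ w * f w - f w₁ = ∑' w, T.workProb ρ w * (f w - f w₁) := by
    simp_rw [mul_sub]
    rw [hsf.tsum_sub (hs.mul_right _), tsum_mul_right, h1, one_mul]
  have hr : ε + 2 * ‖f‖ * (1 - ∑' w, T.workProb ρ w * window w₁ δ w) =
      ∑' w, T.workProb ρ w * (ε + 2 * ‖f‖ * (1 - window w₁ δ w)) := by
    have : ∀ w, T.workProb ρ w * (ε + 2 * ‖f‖ * (1 - window w₁ δ w)) =
        T.workProb ρ w * (ε + 2 * ‖f‖) - 2 * ‖f‖ * (T.workProb ρ w * window w₁ δ w) := by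
      intro w; ring
    simp_rw [this]
    rw [(hs.mul_right _).tsum_sub (hsw.mul_left _), tsum_mul_right, tsum_mul_left, h1]
    ring
  have hpos : ∀ w, 0 ≤ ε + 2 * ‖f‖ * (1 - window w₁ δ w) := fun w =>
    (abs_nonneg _).trans (hpt w)
  have hsr : Summable fun w => T.workProb ρ w * (ε + 2 * ‖f‖ * (1 - window w₁ δ w)) := by
    refine hbdd (C := ε + 2 * ‖f‖) fun w => ?_
    rw [abs_of_nonneg (hpos w)]
    nlinarith [window_nonneg w₁ δ w, norm_nonneg f]
  rw [hl, hr, ← Real.norm_eq_abs]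
  refine tsum_of_norm_bounded hsr.hasSum fun w => ?_
  rw [norm_mul, Real.norm_of_nonneg (hp w), Real.norm_eq_abs]
  exact mul_le_mul_of_nonneg_left (hpt w) (hp w)

/-- If the work is concentrated in shrinking windows around `w₁`, its law tends to the Dirac law
in `w₁`. -/
lemma workTendsto_dirac {T : ℕ → ThermalOperation β E E'} {w₁ : ℝ} {δ : ℕ → ℝ}
    (hδ : Tendsto δ atTop (𝓝 0))
    (h : Tendsto (fun n => ∑' w, (T n).workProb ρ w * window w₁ (δ n) w) atTop (𝓝 1)) :
    WorkTendsto T ρ (Measure.dirac w₁) := by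
  intro f
  rw [integral_dirac, Metric.tendsto_atTop']
  intro ε hε
  obtain ⟨r, hr, hfr⟩ := Metric.continuousAt_iff.1 (f.continuous.continuousAt (x := w₁)) (ε / 2)
    (half_pos hε)
  have h2 : Tendsto (fun n => ε / 2 + 2 * ‖f‖ *
      (1 - ∑' w, (T n).workProb ρ w * window w₁ (δ n) w)) atTop
      (𝓝 (ε / 2 + 2 * ‖f‖ * (1 - 1))) := ((h.const_sub 1).const_mul _).const_add _
  rw [sub_self, mul_zero, add_zero] at h2
  have h3 := (h2.eventually (gt_mem_nhds (half_lt_self hε))).and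
    (hδ.eventually (gt_mem_nhds hr))
  obtain ⟨n₀, hn₀⟩ := eventually_atTop.1 h3
  refine ⟨n₀, fun n hn => ?_⟩
  obtain ⟨h4, h5⟩ := hn₀ n hn.le
  rw [Real.dist_eq]
  refine (abs_tsum_workProb_mul_sub_le hρ hd (T n) f (fun w hw => ?_) (half_pos hε).le).trans_lt h4
  rw [← Real.dist_eq]
  exact (hfr (by rw [Real.dist_eq]; linarith)).le

end weakLimit

lemma isBoundedLaw_dirac {c : ℝ} (hc : 0 ≤ c) (w₁ : ℝ) : IsBoundedLaw c (Measure.dirac w₁) where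
  prob := inferInstance
  integrable := integrable_dirac (by simp)
  bounded := by
    rw [integral_dirac, ae_dirac_eq]
    simpa using hc

/-- Concentrated work and final levels distributed according to `y`, attained in a limit. -/
lemma exists_operations_tendsto (hβ : 0 < β) {ρ : Matrix S S ℂ} (hρ : IsState ρ)
    (hd : (dephase E ρ).IsDiag) {D : Finset S} (hD : ∀ s, s ∉ D → population ρ s = 0)
    {y : S → ℝ} (hy : ∀ s, 0 ≤ y s) (hy1 : ∑ s, y s = 1) {w₁ : ℝ}
    (h : ∀ s', y s' * ∑ s ∈ D, Real.exp (β * (w₁ + E' s' - E s)) < 1) :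
    ∃ T : ℕ → ThermalOperation β E E', WorkTendsto T ρ (Measure.dirac w₁) ∧
      (∀ n s' t', s' ≠ t' → (T n).finalState (gibbsState β E) s' t' = 0) ∧
      ∀ s', Tendsto (fun n => ∑ s, population ρ s * (T n).avg (fun _ => 1) s' s) atTop
        (𝓝 (y s')) := by
  classical
  let δ : ℕ → ℝ := fun n => 1 / ((n : ℝ) + 1)
  have hδpos : ∀ n, 0 < δ n := fun n => by positivity
  have hδ : Tendsto δ atTop (𝓝 0) := tendsto_one_div_add_atTop_nhds_zero_nat
  choose T hT hT' using fun n => exists_operation_near hβ D hy hy1 h (hδpos n)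
  have hlow : ∀ n (f : ℝ → ℝ), (∀ w, 0 ≤ f w) → (∀ w, |w - w₁| ≤ δ n → f w = 1) → ∀ s',
      y s' - δ n ≤ ∑ s, population ρ s * (T n).avg f s' s := by
    intro n f hf hf1 s'
    calc y s' - δ n = ∑ s, population ρ s * (y s' - δ n) := by
          rw [← Finset.sum_mul, hρ.sum_population, one_mul]
      _ ≤ _ := Finset.sum_le_sum fun s _ => by
          by_cases hs : s ∈ D
          · exact mul_le_mul_of_nonneg_left (hT' n f hf hf1 s hs s') (hρ.population_nonneg s)
          · simp [hD s hs]
  refine ⟨T, workTendsto_dirac hρ hd hδ ?_, hT, fun s' => ?_⟩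
  · have hl : Tendsto (fun n => ∑ s', (y s' - δ n)) atTop (𝓝 (∑ s', (y s' - 0))) :=
      tendsto_finsetSum _ fun s' _ => hδ.const_sub _
    simp only [sub_zero, hy1] at hl
    refine tendsto_of_tendsto_of_tendsto_of_le_of_le hl tendsto_const_nhds (fun n => ?_)
      (fun n => ?_)
    · simp only
      rw [tsum_workProb_eq_sum hρ hd (T n) (window_nonneg w₁ (δ n)) (window_le_one w₁ (δ n))]
      simp_rw [Finset.mul_sum]
      rw [Finset.sum_comm]
      exact Finset.sum_le_sum fun s' _ =>
        hlow n _ (window_nonneg w₁ (δ n)) (fun w hw => window_eq_one hw) s'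
    · simp only
      rw [tsum_workProb_eq_sum hρ hd (T n) (window_nonneg w₁ (δ n)) (window_le_one w₁ (δ n)),
        ← hρ.sum_population]
      exact Finset.sum_le_sum fun s _ => mul_le_of_le_one_right (hρ.population_nonneg s)
        ((T n).sum_avg_le_one (window_nonneg w₁ (δ n)) (window_le_one w₁ (δ n)) s)
  · have hl : Tendsto (fun n => y s' - δ n) atTop (𝓝 (y s' - 0)) := hδ.const_sub _
    -- Only lower bounds on the final populations are available; normalisation converts those of the
    -- other levels into an upper bound for `s'`.
    have hu : Tendsto (fun n => 1 - ∑ t ∈ Finset.univ.erase s', (y t - δ n)) atTop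
        (𝓝 (1 - ∑ t ∈ Finset.univ.erase s', (y t - 0))) :=
      (tendsto_finsetSum _ fun s' _ => hδ.const_sub _).const_sub 1
    have hye : 1 - ∑ t ∈ Finset.univ.erase s', (y t - 0) = y s' := by
      have := Finset.add_sum_erase Finset.univ y (Finset.mem_univ s')
      simp only [sub_zero]
      linarith
    rw [hye] at hu
    rw [sub_zero] at hl
    refine tendsto_of_tendsto_of_tendsto_of_le_of_le hl hu
      (fun n => hlow n _ (by simp) (by simp) s') (fun n => ?_)
    have h1 : ∑ t, ∑ s, population ρ s * (T n).avg (fun _ => 1) t s = 1 := by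
      rw [Finset.sum_comm]
      simp_rw [← Finset.mul_sum, (T n).sum_avg_one, mul_one]
      exact hρ.sum_population
    have h2 := Finset.add_sum_erase Finset.univ
      (fun t => ∑ s, population ρ s * (T n).avg (fun _ => 1) t s) (Finset.mem_univ s')
    have h3 : ∑ t ∈ Finset.univ.erase s', (y t - δ n) ≤ ∑ t ∈ Finset.univ.erase s',
        ∑ s, population ρ s * (T n).avg (fun _ => 1) t s :=
      Finset.sum_le_sum fun t _ => hlow n _ (by simp) (by simp) t
    simp only at h2 ⊢
    linarith

lemma sum_filter_exp_eq (ρ : Matrix S S ℂ) [DecidablePred fun s => population ρ s ≠ 0] (a : ℝ) :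
    ∑ s ∈ Finset.univ.filter (fun s => population ρ s ≠ 0), Real.exp (β * (a - E s)) =
      Real.exp (β * a) * supportSum β E (population ρ) := by
  rw [Finset.sum_filter, supportSum, Finset.mul_sum]
  refine Finset.sum_congr rfl fun s _ => ?_
  by_cases hs : population ρ s = 0
  · simp [hs]
  · rw [if_pos hs, if_neg hs, one_mul, ← Real.exp_add]
    ring_nf

/-- For the final Gibbs distribution the factors `e^{±βE'_{s'}}` cancel, so the condition is the
same for every `s'` and says that `w₁` lies below the single-shot work. -/
lemma dirac_mem_extractionLaws (hβ : 0 < β) {ρ : Matrix S S ℂ} (hρ : IsState ρ)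
    (hd : (dephase E ρ).IsDiag) {w₁ : ℝ}
    (hw : w₁ < singleShotWork β E E' (population ρ)) :
    Measure.dirac w₁ ∈ extractionLaws β E E' ρ := by
  classical
  have := hρ.nonempty
  have hZ' := partitionFunction_pos (β := β) (E := E')
  have hA : 0 < supportSum β E (population ρ) := hρ.supportSum_pos
  obtain ⟨T, hT, -⟩ := exists_operations_tendsto (E' := E') (w₁ := w₁) hβ hρ hd
    (D := Finset.univ.filter fun s => population ρ s ≠ 0) (by simp)
    (isState_gibbsState (β := β) (E := E')).population_nonneg
    (isState_gibbsState (β := β) (E := E')).sum_population (by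
      intro s'
      rw [sum_filter_exp_eq, population_gibbsState]
      rw [singleShotWork_eq, one_div, inv_mul_eq_div, lt_div_iff₀ hβ] at hw
      have h1 : Real.exp (β * w₁) * supportSum β E (population ρ) < partitionFunction β E' := by
        rw [← Real.exp_log hA, ← Real.exp_add, ← Real.exp_log hZ', Real.exp_lt_exp]
        linarith
      calc _ = Real.exp (β * w₁) * supportSum β E (population ρ) / partitionFunction β E' *
            (Real.exp (-β * E' s') * Real.exp (β * E' s')) := by
            rw [mul_add, Real.exp_add]
            ring
        _ = Real.exp (β * w₁) * supportSum β E (population ρ) / partitionFunction β E' := by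
            rw [← Real.exp_add]
            simp
        _ < 1 := (div_lt_one hZ').2 h1)
  exact ⟨T, hT⟩

lemma dirac_mem_formationLaws (hβ : 0 < β) {ρ : Matrix S S ℂ} (hρ : IsState ρ)
    (hd : (dephase E' ρ).IsDiag) {w₁ : ℝ}
    (hw : singleShotWorkOfFormation β E E' (population ρ) < -w₁) :
    Measure.dirac w₁ ∈ formationLaws β E E' ρ := by
  classical
  have := hρ.nonempty
  have hZ := partitionFunction_pos (β := β) (E := E)
  have hM := hρ.iSup_population_pos (β := β) E'
  have hγ := isState_gibbsState (β := β) (E := E)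
  obtain ⟨T, hT, hoff, hdiag⟩ := exists_operations_tendsto (E' := E') (w₁ := w₁) hβ hγ
    isDiag_dephase_gibbsState (D := Finset.univ) (by simp) hρ.population_nonneg
    hρ.sum_population (by
      intro s'
      have h1 : ∑ s, Real.exp (β * (w₁ + E' s' - E s)) =
          Real.exp (β * w₁) * Real.exp (β * E' s') * partitionFunction β E := by
        rw [partitionFunction, Finset.mul_sum]
        refine Finset.sum_congr rfl fun s _ => ?_
        rw [← Real.exp_add, ← Real.exp_add]
        ring_nf
      have h2 : population ρ s' * Real.exp (β * E' s') ≤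
          ⨆ s, population ρ s * Real.exp (β * E' s) :=
        le_ciSup (f := fun s => population ρ s * Real.exp (β * E' s))
          (Set.finite_range _).bddAbove s'
      have h3 : singleShotWorkOfFormation β E E' (population ρ) =
          (Real.log (partitionFunction β E) +
            Real.log (⨆ s, population ρ s * Real.exp (β * E' s))) / β := by
        unfold singleShotWorkOfFormation maxFreeEnergy
        ring
      rw [h3, div_lt_iff₀ hβ] at hw
      calc _ = population ρ s' * Real.exp (β * E' s') *
            (Real.exp (β * w₁) * partitionFunction β E) := by rw [h1]; ring
        _ ≤ (⨆ s, population ρ s * Real.exp (β * E' s)) *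
            (Real.exp (β * w₁) * partitionFunction β E) :=
            mul_le_mul_of_nonneg_right h2 (by positivity)
        _ = Real.exp (Real.log (⨆ s, population ρ s * Real.exp (β * E' s)) +
            (β * w₁ + Real.log (partitionFunction β E))) := by
            rw [Real.exp_add, Real.exp_add, Real.exp_log hM, Real.exp_log hZ]
        _ < 1 := by
            rw [Real.exp_lt_one_iff]
            linarith)
  refine ⟨T, hT, ?_⟩
  -- Diagonal entries converge by construction; off-diagonal ones vanish on both sides, in the limit
  -- because the basis diagonalises the dephased state.
  refine tendsto_pi_nhds.2 fun s' => tendsto_pi_nhds.2 fun t' => ?_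
  by_cases hst : s' = t'
  · subst hst
    simp only [dephase, Matrix.of_apply, if_true, apply_self_eq_population hρ.1,
      (T _).finalState_apply_self hγ.1 isDiag_dephase_gibbsState]
    exact (Complex.continuous_ofReal.tendsto _).comp (hdiag s')
  · rw [hd hst]
    simp [dephase, hoff _ _ _ hst]

/-! ### The limits of vanishing fluctuations -/

lemma tendsto_boundedWork (hβ : 0 < β) {ρ : Matrix S S ℂ} (hρ : IsState ρ)
    (hd : (dephase E ρ).IsDiag) :
    Tendsto (fun c : ℝ => boundedWork β E E' ρ c) (𝓝[>] 0)
      (𝓝 ((singleShotWork β E E' (population ρ) : ℝ) : EReal)) := by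
  set W := singleShotWork β E E' (population ρ) with hW
  have hu : Tendsto (fun c : ℝ => ((W + c : ℝ) : EReal)) (𝓝[>] 0) (𝓝 (W : EReal)) := by
    have : Continuous fun c : ℝ => ((W + c : ℝ) : EReal) :=
      continuous_coe_real_ereal.comp (continuous_const.add continuous_id)
    have h := this.tendsto 0
    rw [add_zero] at h
    exact h.mono_left nhdsWithin_le_nhds
  refine tendsto_of_tendsto_of_tendsto_of_le_of_le' tendsto_const_nhds hu ?_ ?_
  · filter_upwards [self_mem_nhdsWithin] with c hc
    -- Only values strictly below `W` were shown to be attained, which suffices for the supremum.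
    refine EReal.ge_of_forall_gt_iff_ge.1 fun w₁ hw₁ => ?_
    refine le_iSup₂_of_le (Measure.dirac w₁) ⟨dirac_mem_extractionLaws hβ hρ hd
      (EReal.coe_lt_coe_iff.1 hw₁), isBoundedLaw_dirac (le_of_lt hc) w₁⟩ ?_
    rw [integral_dirac]
  · filter_upwards with c
    refine iSup₂_le fun P hP => ?_
    exact EReal.coe_le_coe_iff.2 (mean_le_singleShotWork_add hβ hρ hd hP.2 hP.1)

lemma tendsto_boundedWorkOfFormation (hβ : 0 < β) {ρ : Matrix S S ℂ} (hρ : IsState ρ)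
    (hd : (dephase E' ρ).IsDiag) :
    Tendsto (fun c : ℝ => boundedWorkOfFormation β E E' ρ c) (𝓝[>] 0)
      (𝓝 ((singleShotWorkOfFormation β E E' (population ρ) : ℝ) : EReal)) := by
  set W := singleShotWorkOfFormation β E E' (population ρ) with hW
  have hl : Tendsto (fun c : ℝ => ((W - c : ℝ) : EReal)) (𝓝[>] 0) (𝓝 (W : EReal)) := by
    have : Continuous fun c : ℝ => ((W - c : ℝ) : EReal) :=
      continuous_coe_real_ereal.comp (continuous_const.sub continuous_id)
    have h := this.tendsto 0
    rw [sub_zero] at h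
    exact h.mono_left nhdsWithin_le_nhds
  refine tendsto_of_tendsto_of_tendsto_of_le_of_le' hl tendsto_const_nhds ?_ ?_
  · filter_upwards with c
    refine le_iInf₂ fun P hP => ?_
    exact EReal.coe_le_coe_iff.2 (singleShotWorkOfFormation_sub_le hβ hρ hP.2 hP.1)
  · filter_upwards [self_mem_nhdsWithin] with c hc
    refine EReal.le_of_forall_lt_iff_le.1 fun w hw => ?_
    refine iInf₂_le_of_le (Measure.dirac (-w)) ⟨dirac_mem_formationLaws hβ hρ hd
      (by rw [neg_neg]; exact EReal.coe_lt_coe_iff.1 hw), isBoundedLaw_dirac (le_of_lt hc) (-w)⟩ ?_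
    rw [integral_dirac, neg_neg]

end

end FluctuatingWork

/-- The energies `E` of the initial and `E'` of the final Hamiltonian are arbitrary. In either part
the energy eigenbasis is chosen such that it diagonalises the dephased state. -/
theorem mainTheorem7 {S : Type*} [Fintype S] (β : ℝ) (hβ : 0 < β) (E E' : S → ℝ) :
    (∀ ρ : Matrix S S ℂ, FluctuatingWork.IsState ρ → (FluctuatingWork.dephase E ρ).IsDiag →
      Tendsto (fun c : ℝ => FluctuatingWork.boundedWork β E E' ρ c) (𝓝[>] 0)
        (𝓝 ((FluctuatingWork.singleShotWork β E E' (FluctuatingWork.population ρ) : ℝ) : EReal)))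
    ∧
    (∀ ρ : Matrix S S ℂ, FluctuatingWork.IsState ρ → (FluctuatingWork.dephase E' ρ).IsDiag →
      Tendsto (fun c : ℝ => FluctuatingWork.boundedWorkOfFormation β E E' ρ c) (𝓝[>] 0)
        (𝓝 ((FluctuatingWork.singleShotWorkOfFormation β E E'
          (FluctuatingWork.population ρ) : ℝ) : EReal))) := by
  exact ⟨fun _ hρ hd => FluctuatingWork.tendsto_boundedWork hβ hρ hd,
    fun _ hρ hd => FluctuatingWork.tendsto_boundedWorkOfFormation hβ hρ hd⟩
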